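/- Let $\mathbb D$ be the open unit disc in $\mathbb C$ and let $\mathrm{Aut}(\mathbb D)$ be the group of its biholomorphic self-maps. Each of them can be written uniquely as $z\mapsto\lambda\frac{z-\alpha}{1-\bar\alpha z}$ with $|\lambda|=1$, $\alpha\in\mathbb D$, and $\mathrm{Aut}(\mathbb D)$ is regarded as a smooth real $3$-manifold through the coordinates $(\lambda,\alpha)\in S^1\times\mathbb D$ (equivalently, through the local coordinates $(\theta,\alpha)$ with $\lambda=e^{i\theta}$). For $a\in\mathbb D$ put $\varphi_a(z)=\frac{a-z}{1-\bar a z}$, and let $\mathbb Z_2=\{\pm1\}$ act on $\mathrm{Aut}(\mathbb D)$ by $(+1)\cdot\varphi=\varphi$, $(-1)\cdot\varphi=\varphi\circ\varphi_a$; write $\mathrm{Aut}(\mathbb D)/_a\mathbb Z_2$ for the quotient. (For $a=0$ the action is $(-1)\cdot\varphi=\varphi\circ(-\mathrm{id})$.) Let $\mathbb G=\{(z_1+z_2,z_1z_2):z_1,z_2\in\mathbb D\}$ be the symmetrized bidisc and $\Delta=\{(2z,z^2):z\in\mathbb D\}$. The group $\mathrm{Aut}(\mathbb D)$ acts on $\mathbb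 G$ by the automorphisms $H_\varphi(z_1+z_2,z_1z_2)=(\varphi(z_1)+\varphi(z_2),\varphi(z_1)\varphi(z_2))$; "orbit" refers to this action. For $c\in(0,1)$ let $$\mathscr L_c=\Big\{(z_1+z_2,z_1z_2): z_1,z_2\in\mathbb D,\ \Big|\frac{z_1-z_2}{1-\bar z_1z_2}\Big|=c\Big\}.$$ **Theorem.** 1. For every $c\in(0,1)$, $\mathscr L_c$ is the orbit of $(c,0)$, and every orbit of a point of $\mathbb G\setminus\Delta$ is $\mathscr L_c$ for some $c\in(0,1)$. Each $\mathscr L_c$, $c\in(0,1)$, is a smooth embedded real $3$-dimensional submanifold of $\mathbb C^2=\mathbb R^4$. 2. For every $a\in\mathbb D$ the above $\mathbb Z_2$-action is free, and $\mathrm{Aut}(\mathbb D)/_a\mathbb Z_2$ is a smooth manifold for which the quotient map $\mathrm{Aut}(\mathbb D)\to\mathrm{Aut}(\mathbb D)/_a\mathbb Z_2$ is a local diffeomorphism. 3. For every $c\in(0,1)$, $\mathscr L_c$ (with its structure of embedded submanifold) is diffeomorphic to $\mathrm{Aut}(\mathbb D)/_c\mathbb Z_2$ and to $\mathrm{Aut}(\mathbb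 D)/_0\mathbb Z_2$, and $\mathrm{Aut}(\mathbb D)/_c\mathbb Z_2$ is diffeomorphic to $\mathrm{Aut}(\mathbb D)/_0\mathbb Z_2$. 4. For all $c,d\in(0,1)$, $\mathscr L_c$ and $\mathscr L_d$ are diffeomorphic. -/

import Mathlib

open scoped Manifold ContDiff ComplexConjugate Topology

namespace SymBidisc

noncomputable section

/-! ### The unit disc and its automorphism group -/

/-- The open unit disc `𝔻` of `ℂ`, an open submanifold of `ℂ`. -/
def disc : TopologicalSpace.Opens ℂ := ⟨Metric.ball 0 1, Metric.isOpen_ball⟩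

theorem mem_disc {z : ℂ} : z ∈ disc ↔ ‖z‖ < 1 := by
  change z ∈ Metric.ball (0 : ℂ) 1 ↔ _
  simp

theorem disc_norm_lt (z : disc) : ‖(z : ℂ)‖ < 1 := mem_disc.1 z.2

/-- A self-map of the disc is holomorphic. -/
def IsHolo (φ : disc → disc) : Prop :=
  ∃ f : ℂ → ℂ, DifferentiableOn ℂ f (disc : Set ℂ) ∧ ∀ z : disc, (φ z : ℂ) = f z

theorem IsHolo.comp {φ ψ : disc → disc} (hφ : IsHolo φ) (hψ : IsHolo ψ) : IsHolo (φ ∘ ψ) := by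
  obtain ⟨f, hf, hf'⟩ := hφ
  obtain ⟨g, hg, hg'⟩ := hψ
  refine ⟨f ∘ g, hf.comp hg ?_, fun z => ?_⟩
  · intro z hz
    have := hg' ⟨z, hz⟩
    rw [SetLike.mem_coe, ← this]
    exact (ψ ⟨z, hz⟩).2
  · rw [Function.comp_apply, hf', hg', Function.comp_apply]

theorem IsHolo.id : IsHolo id := ⟨fun z => z, differentiableOn_id, fun _ => rfl⟩

/-- The group of biholomorphic self-maps of the disc, under composition. -/
def discAutSubgroup : Subgroup (Equiv.Perm disc) where
  carrier := {φ | IsHolo φ ∧ IsHolo φ.symm}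
  mul_mem' := fun {_ _} ha hb => ⟨ha.1.comp hb.1, hb.2.comp ha.2⟩
  one_mem' := ⟨IsHolo.id, IsHolo.id⟩
  inv_mem' := fun {_} ha => ⟨ha.2, ha.1⟩

/-- `Aut(𝔻)`. -/
def DiscAut : Type := discAutSubgroup

instance : Group DiscAut := inferInstanceAs (Group discAutSubgroup)

instance : CoeFun DiscAut (fun _ => disc → disc) := ⟨fun φ => φ.1⟩

theorem DiscAut.ext {φ ψ : DiscAut} (h : ∀ z, (φ z : ℂ) = ψ z) : φ = ψ :=
  Subtype.ext (Equiv.ext fun z => Subtype.ext (h z))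

theorem DiscAut.mul_apply (φ ψ : DiscAut) (z : disc) : (φ * ψ) z = φ (ψ z) := rfl

theorem one_sub_ne_zero {a z : ℂ} (ha : ‖a‖ < 1) (hz : ‖z‖ < 1) : 1 - conj a * z ≠ 0 := by
  intro h
  have h1 : conj a * z = 1 := (sub_eq_zero.1 h).symm
  have h2 : ‖a‖ * ‖z‖ = 1 := by
    rw [← RCLike.norm_conj a, ← norm_mul, h1, norm_one]
  nlinarith [norm_nonneg a, norm_nonneg z]

theorem normSq_mobius (a z : ℂ) :
    ‖1 - conj a * z‖ ^ 2 - ‖z - a‖ ^ 2 = (1 - ‖a‖ ^ 2) * (1 - ‖z‖ ^ 2) := by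
  simp only [← Complex.normSq_eq_norm_sq, Complex.normSq_apply, Complex.sub_re, Complex.sub_im,
    Complex.mul_re, Complex.mul_im, Complex.conj_re, Complex.conj_im, Complex.one_re,
    Complex.one_im]
  ring

/-- The map `z ↦ λ (z - α) / (1 - ᾱ z)` of the disc. -/
def mobiusFun (lam : Circle) (α : disc) (z : disc) : disc :=
  ⟨lam * ((z - α) / (1 - conj (α : ℂ) * z)), by
    have ha := disc_norm_lt α
    have hz := disc_norm_lt z
    have h0 := one_sub_ne_zero ha hz
    rw [mem_disc, norm_mul, Circle.norm_coe, one_mul, norm_div,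
      div_lt_one (norm_pos_iff.2 h0)]
    have := normSq_mobius α z
    refine lt_of_pow_lt_pow_left₀ 2 (norm_nonneg _) ?_
    have : 0 < (1 - ‖(α : ℂ)‖ ^ 2) * (1 - ‖(z : ℂ)‖ ^ 2) := by
      apply mul_pos <;> nlinarith [norm_nonneg (α : ℂ), norm_nonneg (z : ℂ)]
    linarith⟩

theorem mobiusFun_isHolo (lam : Circle) (α : disc) : IsHolo (mobiusFun lam α) := by
  refine ⟨fun z => lam * ((z - α) / (1 - conj (α : ℂ) * z)), ?_, fun _ => rfl⟩
  refine DifferentiableOn.const_mul (DifferentiableOn.div ?_ ?_ ?_) _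
  · fun_prop
  · fun_prop
  · intro z hz
    exact one_sub_ne_zero (disc_norm_lt α) (mem_disc.1 hz)

/-- The point `-λα`. -/
def invPt (lam : Circle) (α : disc) : disc :=
  ⟨-(lam * α), by
    rw [mem_disc, norm_neg, norm_mul, Circle.norm_coe, one_mul]
    exact disc_norm_lt α⟩

theorem circle_mul_conj (lam : Circle) : (lam : ℂ) * conj (lam : ℂ) = 1 := by
  rw [← Circle.coe_inv_eq_conj, ← Circle.coe_mul]
  simp

theorem mobius_leftInverse (lam : Circle) (α : disc) :
    Function.LeftInverse (mobiusFun lam⁻¹ (invPt lam α)) (mobiusFun lam α) := by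
  intro z
  apply Subtype.ext
  have ha := disc_norm_lt α
  have h1 := one_sub_ne_zero ha (disc_norm_lt z)
  have h2 := one_sub_ne_zero (disc_norm_lt (invPt lam α)) (disc_norm_lt (mobiusFun lam α z))
  have h3 := one_sub_ne_zero ha ha
  have hl := circle_mul_conj lam
  simp only [mobiusFun, invPt, Circle.coe_inv_eq_conj, map_neg, map_mul] at h2 ⊢
  have h2' : 1 - -(conj (lam : ℂ) * conj (α : ℂ)) *
      (lam * ((z - α) / (1 - conj (α : ℂ) * z))) =
      (1 - conj (α : ℂ) * α) / (1 - conj (α : ℂ) * z) := by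
    rw [eq_div_iff h1]
    field_simp
    linear_combination (conj (α : ℂ) * (z - α)) * hl
  have h4 : (lam : ℂ) * ((z - α) / (1 - conj (α : ℂ) * z)) - -(lam * α) =
      lam * z * ((1 - conj (α : ℂ) * α) / (1 - conj (α : ℂ) * z)) := by
    have h1' : 1 - (z : ℂ) * conj (α : ℂ) ≠ 0 := by rwa [mul_comm]
    field_simp
    ring
  rw [h2', h4, mul_div_cancel_right₀ _ (div_ne_zero h3 h1)]
  linear_combination (z : ℂ) * hl

theorem invPt_invPt (lam : Circle) (α : disc) : invPt lam⁻¹ (invPt lam α) = α := by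
  apply Subtype.ext
  have hl := circle_mul_conj lam
  simp only [invPt, Circle.coe_inv_eq_conj]
  linear_combination (α : ℂ) * hl

/-- The automorphism `z ↦ λ (z - α) / (1 - ᾱ z)` of the disc. -/
def mobius (lam : Circle) (α : disc) : DiscAut :=
  ⟨{ toFun := mobiusFun lam α
     invFun := mobiusFun lam⁻¹ (invPt lam α)
     left_inv := mobius_leftInverse lam α
     right_inv := by
       have := mobius_leftInverse lam⁻¹ (invPt lam α)
       rwa [inv_inv, invPt_invPt] at this },
    mobiusFun_isHolo _ _, mobiusFun_isHolo _ _⟩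

theorem mobius_apply (lam : Circle) (α z : disc) :
    ((mobius lam α) z : ℂ) = lam * ((z - α) / (1 - conj (α : ℂ) * z)) := rfl

theorem mobius_self (lam : Circle) (α : disc) : ((mobius lam α) α : ℂ) = 0 := by
  simp [mobius_apply]

instance : Zero disc := ⟨⟨0, by simp [mem_disc]⟩⟩

theorem disc_coe_zero : ((0 : disc) : ℂ) = 0 := rfl

/-- The Schwarz inequality for a holomorphic self-map of the disc fixing the origin. -/
theorem norm_le_of_fix {φ : disc → disc} (h : IsHolo φ) (h0 : (φ 0 : ℂ) = 0) (z : disc) :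
    ‖(φ z : ℂ)‖ ≤ ‖(z : ℂ)‖ := by
  obtain ⟨f, hf, hf'⟩ := h
  rw [hf']
  have hz := z.2
  refine Complex.norm_le_norm_of_mapsTo_ball (R := 1) hf ?_ ?_ (disc_norm_lt z)
  · intro w hw
    have := hf' ⟨w, hw⟩
    simp only at this
    rw [← this]
    exact Metric.ball_subset_closedBall (φ ⟨w, hw⟩).2
  · rw [← disc_coe_zero, ← hf', h0]; rfl

theorem rotation_of_fix (φ : DiscAut) (h0 : (φ 0 : ℂ) = 0) :
    ∃ lam : Circle, ∀ z : disc, (φ z : ℂ) = lam * z := by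
  have hinv : (φ⁻¹ : DiscAut) 0 = 0 := by
    have h : φ 0 = 0 := Subtype.ext h0
    change Equiv.symm φ.1 0 = 0
    rw [Equiv.symm_apply_eq]
    exact h.symm
  have hn : ∀ z : disc, ‖(φ z : ℂ)‖ = ‖(z : ℂ)‖ := by
    intro z
    refine le_antisymm (norm_le_of_fix φ.2.1 h0 z) ?_
    have h1 := norm_le_of_fix (φ := (φ⁻¹ : DiscAut).1) φ.2.2 (by rw [hinv]; rfl) (φ z)
    rwa [← DiscAut.mul_apply, inv_mul_cancel] at h1
  obtain ⟨f, hf, hf'⟩ := φ.2.1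
  have hfz : ∀ z ∈ Metric.ball (0 : ℂ) 1, ‖f z‖ = ‖z‖ := by
    intro z hz
    have h1 := hn ⟨z, hz⟩
    rwa [hf'] at h1
  have hf0 : f 0 = 0 := by
    rw [← disc_coe_zero, ← hf', h0]; rfl
  have hhalf : (1 / 2 : ℂ) ∈ Metric.ball (0 : ℂ) 1 := by simp; norm_num
  have heq : ‖dslope f 0 (1 / 2)‖ = 1 / 1 := by
    rw [dslope_of_ne f (by norm_num), slope_def_module, hf0, norm_smul, sub_zero, sub_zero,
      hfz _ hhalf]
    norm_num
  have haff := Complex.affine_of_mapsTo_ball_of_norm_dslope_eq_div (R₁ := 1) (R₂ := 1)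
    (f := f) (c := 0) hf (by
      intro z hz
      rw [hf0, mem_closedBall_zero_iff, hfz z hz]
      exact (mem_ball_zero_iff.1 hz).le) hhalf heq
  refine ⟨⟨dslope f 0 (1 / 2), ?_⟩, fun z => ?_⟩
  · change _ ∈ Metric.sphere (0 : ℂ) 1
    rw [mem_sphere_zero_iff_norm, heq]; norm_num
  · rw [hf', haff z.2, hf0]
    simp only [sub_zero, zero_add, smul_eq_mul]
    ring

theorem mobius_injective : Function.Injective (fun p : Circle × disc => mobius p.1 p.2) := by
  rintro ⟨lam, α⟩ ⟨mu, β⟩ h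
  simp only at h
  have h1 : ((mobius mu β) α : ℂ) = 0 := by rw [← h, mobius_self]
  have hαβ : α = β := by
    rw [mobius_apply] at h1
    have hb := one_sub_ne_zero (disc_norm_lt β) (disc_norm_lt α)
    have := (mul_eq_zero.1 h1).resolve_left mu.coe_ne_zero
    exact Subtype.ext (sub_eq_zero.1 ((div_eq_zero_iff.1 this).resolve_right hb))
  subst hαβ
  -- compare at a point distinct from `α`
  obtain ⟨z, hz⟩ : ∃ z : disc, z ≠ α := by
    by_cases h : α = 0
    · refine ⟨⟨1 / 2, by rw [mem_disc]; norm_num⟩, fun h' => ?_⟩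
      rw [h] at h'
      have := congrArg Subtype.val h'
      rw [disc_coe_zero] at this
      norm_num at this
    · exact ⟨0, fun h' => h h'.symm⟩
  have h2 : ((mobius lam α) z : ℂ) = (mobius mu α) z := by rw [h]
  rw [mobius_apply, mobius_apply] at h2
  have h3 : ((z : ℂ) - α) / (1 - conj (α : ℂ) * z) ≠ 0 :=
    div_ne_zero (sub_ne_zero.2 fun h => hz (Subtype.ext h))
      (one_sub_ne_zero (disc_norm_lt α) (disc_norm_lt z))
  have h4 : lam = mu := Circle.ext (mul_right_cancel₀ h3 h2)
  rw [h4]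

theorem mobius_surjective : Function.Surjective (fun p : Circle × disc => mobius p.1 p.2) := by
  intro φ
  set α : disc := φ⁻¹ 0 with hα
  have hφα : φ α = 0 := by
    change (φ * φ⁻¹) 0 = 0
    rw [mul_inv_cancel]; rfl
  obtain ⟨lam, hlam⟩ := rotation_of_fix (φ * (mobius 1 α)⁻¹) (by
    have : (mobius 1 α)⁻¹ 0 = α := by
      have h : (mobius 1 α) α = 0 := Subtype.ext (mobius_self 1 α)
      change ((mobius 1 α).1)⁻¹ 0 = α
      rw [Equiv.Perm.inv_eq_iff_eq]
      exact h.symm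
    rw [DiscAut.mul_apply, this, hφα]; rfl)
  refine ⟨(lam, α), ?_⟩
  apply DiscAut.ext
  intro z
  have := hlam ((mobius 1 α) z)
  rw [← DiscAut.mul_apply, inv_mul_cancel_right] at this
  rw [this, mobius_apply, mobius_apply]
  simp

/-- Every automorphism of the disc is uniquely of the form `z ↦ λ (z - α) / (1 - ᾱ z)` with
`|λ| = 1` and `|α| < 1`. -/
def paramEquiv : Circle × disc ≃ DiscAut :=
  Equiv.ofBijective (fun p => mobius p.1 p.2) ⟨mobius_injective, mobius_surjective⟩

theorem paramEquiv_apply (p : Circle × disc) : paramEquiv p = mobius p.1 p.2 := rfl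

/-! ### The manifold structure of `Aut(𝔻)`

The coordinates `(e ^ (iθ), α)` identify `Aut(𝔻)` with `S¹ × 𝔻`; the local coordinates of the
manifold structure are `(θ, α)`, that is, the structure is the one of `S¹ × 𝔻`. -/

instance : TopologicalSpace DiscAut := TopologicalSpace.induced paramEquiv.symm inferInstance

/-- The coordinates `(λ, α)` on `Aut(𝔻)`. -/
def paramHomeo : DiscAut ≃ₜ Circle × disc :=
  paramEquiv.symm.toHomeomorphOfIsInducing ⟨rfl⟩

theorem paramHomeo_symm_apply (p : Circle × disc) : paramHomeo.symm p = mobius p.1 p.2 := rfl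

theorem paramHomeo_mobius (lam : Circle) (α : disc) :
    paramHomeo (mobius lam α) = (lam, α) := paramHomeo.apply_symm_apply (lam, α)

/-- The model space of the three-dimensional manifold `S¹ × 𝔻`. -/
abbrev Model : Type := ModelProd (EuclideanSpace ℝ (Fin 1)) ℂ

/-- The model (without boundary) of the real three-dimensional manifold `S¹ × 𝔻`. -/
abbrev modelI :
    ModelWithCorners ℝ (EuclideanSpace ℝ (Fin 1) × ℂ) Model :=
  (𝓡 1).prod 𝓘(ℝ, ℂ)

instance : ChartedSpace Model DiscAut where
  atlas := {e | ∃ e' ∈ atlas Model (Circle × disc),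
    e = paramHomeo.toOpenPartialHomeomorph.trans e'}
  chartAt φ := paramHomeo.toOpenPartialHomeomorph.trans (chartAt Model (paramHomeo φ))
  mem_chart_source φ := by simp
  chart_mem_atlas φ := ⟨_, chart_mem_atlas _ _, rfl⟩

instance : IsManifold modelI ∞ DiscAut where
  compatible := by
    rintro _ _ ⟨e, he, rfl⟩ ⟨e', he', rfl⟩
    refine (contDiffGroupoid ∞ modelI).mem_of_eqOnSource
      ((contDiffGroupoid ∞ modelI).compatible he he') ?_
    rw [OpenPartialHomeomorph.trans_symm_eq_symm_trans_symm, OpenPartialHomeomorph.trans_assoc,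
      ← OpenPartialHomeomorph.trans_assoc paramHomeo.toOpenPartialHomeomorph.symm]
    refine OpenPartialHomeomorph.EqOnSource.trans' (Setoid.refl _) ?_
    have h := OpenPartialHomeomorph.symm_trans_self paramHomeo.toOpenPartialHomeomorph
    refine Setoid.trans (OpenPartialHomeomorph.EqOnSource.trans' h (Setoid.refl e')) ?_
    simp

/-! ### The free `ℤ₂`-actions on `Aut(𝔻)` and their quotients -/

/-- The involution `φ_a (z) = (a - z) / (1 - ā z)`; for `a = 0` it is `z ↦ -z`. -/
def involution (a : disc) : DiscAut := mobius (-1) a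

theorem involution_apply (a z : disc) :
    ((involution a) z : ℂ) = (a - z) / (1 - conj (a : ℂ) * z) := by
  rw [involution, mobius_apply, Circle.coe_neg, Circle.coe_one]
  ring

theorem involution_zero_apply (z : disc) : ((involution 0) z : ℂ) = -z := by
  rw [involution_apply, disc_coe_zero]; simp

theorem involution_mul_self (a : disc) : involution a * involution a = 1 := by
  have h := mobius_leftInverse (-1) a
  have h1 : invPt (-1) a = a := by
    apply Subtype.ext
    simp [invPt]
  have h2 : (-1 : Circle)⁻¹ = -1 := by
    apply Circle.ext
    simp
  rw [h1, h2] at h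
  exact DiscAut.ext fun z => congrArg Subtype.val (h z)

theorem involution_ne_one (a : disc) : involution a ≠ 1 := by
  intro h
  -- compare the values at `a` and at `0`
  have h1 : ((involution a) a : ℂ) = a := by rw [h]; rfl
  have h2 : a = 0 := by
    rw [involution, mobius_self] at h1
    exact Subtype.ext h1.symm
  subst h2
  have h3 := involution_zero_apply ⟨1 / 2, by rw [mem_disc]; norm_num⟩
  rw [h] at h3
  change (1 / 2 : ℂ) = -(1 / 2) at h3
  norm_num at h3

theorem coe_ofConjDivSelf (z : ℂ) (hz : z ≠ 0) :
    (Circle.ofConjDivSelf z hz : ℂ) = conj z / z := rfl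

/-- The composition with `φ_a` in the coordinates `(λ, α)`. -/
theorem mobius_mul_involution (lam : Circle) (β a : disc) :
    mobius lam β * involution a =
      mobius (-(lam * Circle.ofConjDivSelf (1 - a * conj (β : ℂ)) (by
        rw [mul_comm]; exact one_sub_ne_zero (disc_norm_lt β) (disc_norm_lt a))))
        (involution a β) := by
  apply DiscAut.ext
  intro z
  have hw := one_sub_ne_zero (disc_norm_lt β) (disc_norm_lt a)
  have hw' := one_sub_ne_zero (disc_norm_lt a) (disc_norm_lt β)
  have hz := one_sub_ne_zero (disc_norm_lt a) (disc_norm_lt z)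
  have k1 := one_sub_ne_zero (disc_norm_lt β) (disc_norm_lt (involution a z))
  have k2 := one_sub_ne_zero (disc_norm_lt (involution a β)) (disc_norm_lt z)
  rw [DiscAut.mul_apply, mobius_apply, mobius_apply]
  rw [involution_apply] at k1 k2 ⊢
  rw [involution_apply]
  have e1 : 1 - conj (β : ℂ) * ((a - z) / (1 - conj (a : ℂ) * z)) =
      (1 - conj (a : ℂ) * z - conj (β : ℂ) * (a - z)) / (1 - conj (a : ℂ) * z) := by
    rw [eq_div_iff hz, sub_mul, mul_assoc, div_mul_cancel₀ _ hz, one_mul]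
  have hwc : 1 - (a : ℂ) * conj (β : ℂ) ≠ 0 := by rwa [mul_comm]
  have e2 : 1 - conj (((a : ℂ) - β) / (1 - conj (a : ℂ) * β)) * z =
      (1 - conj (a : ℂ) * z - conj (β : ℂ) * (a - z)) / (1 - a * conj (β : ℂ)) := by
    simp only [map_div₀, map_sub, map_one, map_mul, Complex.conj_conj]
    field_simp
    ring
  have hD : 1 - conj (a : ℂ) * z - conj (β : ℂ) * (a - z) ≠ 0 := by
    intro h
    rw [e1, h, zero_div] at k1
    exact k1 rfl
  rw [e1, e2]
  simp only [Circle.coe_neg, Circle.coe_mul, coe_ofConjDivSelf, map_sub, map_one, map_mul,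
    Complex.conj_conj]
  have hz' : 1 - (z : ℂ) * conj (a : ℂ) ≠ 0 := by rwa [mul_comm]
  field_simp
  ring

theorem continuous_mul_involution (a : disc) :
    Continuous (fun φ : DiscAut => φ * involution a) := by
  rw [← paramHomeo.symm.comp_continuous_iff', ← paramHomeo.comp_continuous_iff]
  have h : (paramHomeo ∘ ((fun φ : DiscAut => φ * involution a) ∘ paramHomeo.symm)) =
      fun p : Circle × disc =>
        (-(p.1 * Circle.ofConjDivSelf (1 - a * conj (p.2 : ℂ)) (by
          rw [mul_comm]; exact one_sub_ne_zero (disc_norm_lt p.2) (disc_norm_lt a))),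
        involution a p.2) := by
    funext p
    rw [Function.comp_apply, Function.comp_apply, paramHomeo_symm_apply, mobius_mul_involution,
      paramHomeo_mobius]
  rw [h]
  refine Continuous.prodMk ?_ ?_
  · refine continuous_induced_rng.2 ?_
    change Continuous (fun p : Circle × disc => ((-(p.1 * Circle.ofConjDivSelf _ _) : Circle) : ℂ))
    simp only [Circle.coe_neg, Circle.coe_mul, coe_ofConjDivSelf]
    refine (Continuous.mul (by fun_prop) (Continuous.div (by fun_prop) (by fun_prop) ?_)).neg
    intro p
    rw [mul_comm]
    exact one_sub_ne_zero (disc_norm_lt p.2) (disc_norm_lt a)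
  · refine Topology.IsEmbedding.subtypeVal.continuous_iff.2 ?_
    simp only [Function.comp_def, involution_apply]
    refine Continuous.div (by fun_prop) (by fun_prop) ?_
    intro p
    exact one_sub_ne_zero (disc_norm_lt a) (disc_norm_lt p.2)

/-- The two elements `1 ↦ id`, `-1 ↦ φ_a` of `Aut(𝔻)`, indexed by `ℤ₂ = {±1}`. -/
def signAut (a : disc) (u : ℤˣ) : DiscAut := if u = 1 then 1 else involution a

theorem signAut_one (a : disc) : signAut a 1 = 1 := if_pos rfl

theorem signAut_neg_one (a : disc) : signAut a (-1) = involution a := if_neg (by decide)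

theorem signAut_mul (a : disc) (u v : ℤˣ) : signAut a (u * v) = signAut a u * signAut a v := by
  rcases Int.units_eq_one_or u with rfl | rfl <;> rcases Int.units_eq_one_or v with rfl | rfl
  · rw [one_mul, signAut_one, one_mul]
  · rw [one_mul, signAut_one, one_mul]
  · rw [mul_one, signAut_one, mul_one]
  · rw [neg_mul_neg, one_mul, signAut_one, signAut_neg_one, involution_mul_self]

/-- The manifold `Aut(𝔻)`, on which `ℤ₂ = {±1}` acts by `(-1) • φ = φ ∘ φ_a`. -/
def TwistedAut (_a : disc) : Type := DiscAut

variable (a : disc)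

/-- An automorphism as a point of `TwistedAut a`. -/
def toTwisted (φ : DiscAut) : TwistedAut a := φ

/-- The automorphism underlying a point of `TwistedAut a`. -/
def ofTwisted (φ : TwistedAut a) : DiscAut := φ

instance : TopologicalSpace (TwistedAut a) := inferInstanceAs (TopologicalSpace DiscAut)

instance : ChartedSpace Model (TwistedAut a) := inferInstanceAs (ChartedSpace Model DiscAut)

instance : IsManifold modelI ∞ (TwistedAut a) := inferInstanceAs (IsManifold modelI ∞ DiscAut)

instance : T2Space (TwistedAut a) := paramHomeo.symm.t2Space

instance : LocallyCompactSpace (TwistedAut a) := by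
  have : LocallyCompactSpace disc := disc.isOpen.locallyCompactSpace
  exact paramHomeo.isClosedEmbedding.locallyCompactSpace

instance : MulAction ℤˣ (TwistedAut a) where
  smul u φ := toTwisted a (ofTwisted a φ * signAut a u)
  one_smul φ := congrArg (toTwisted a) ((congrArg _ (signAut_one a)).trans (mul_one _))
  mul_smul u v φ := by
    refine congrArg (toTwisted a) ?_
    rw [mul_comm u v, signAut_mul, ← mul_assoc]
    rfl

theorem neg_one_smul_eq (φ : TwistedAut a) :
    (-1 : ℤˣ) • φ = toTwisted a (ofTwisted a φ * involution a) :=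
  congrArg (fun ψ => toTwisted a (ofTwisted a φ * ψ)) (signAut_neg_one a)

instance : IsCancelSMul ℤˣ (TwistedAut a) where
  left_cancel' u φ ψ h := smul_left_cancel u h
  right_cancel' u v φ h := by
    have key : (-1 : ℤˣ) • φ ≠ φ := by
      intro h'
      rw [neg_one_smul_eq] at h'
      exact involution_ne_one a (mul_eq_left.1 h')
    rcases Int.units_eq_one_or u with rfl | rfl <;> rcases Int.units_eq_one_or v with rfl | rfl
    · rfl
    · rw [one_smul] at h; exact absurd h.symm key
    · rw [one_smul] at h; exact absurd h key
    · rfl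

instance : ContinuousConstSMul ℤˣ (TwistedAut a) where
  continuous_const_smul u := by
    rcases Int.units_eq_one_or u with rfl | rfl
    · simp only [one_smul]; exact continuous_id
    · simp only [neg_one_smul_eq]; exact continuous_mul_involution a

/-- The quotient manifold `Aut(𝔻) /ₐ ℤ₂`. -/
abbrev AutModZ2 : Type := MulAction.orbitRel.Quotient ℤˣ (TwistedAut a)

/-- The quotient map `Aut(𝔻) → Aut(𝔻) /ₐ ℤ₂`. -/
def AutModZ2.mk (φ : TwistedAut a) : AutModZ2 a := Quotient.mk _ φ

/-! ### The symmetrized bidisc and its orbits -/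

/-- The symmetrization map `(z₁, z₂) ↦ (z₁ + z₂, z₁ z₂)`. -/
def sym (z : ℂ × ℂ) : ℂ × ℂ := (z.1 + z.2, z.1 * z.2)

/-- The symmetrized bidisc `𝔾`. -/
def symBidisc : Set (ℂ × ℂ) := {x | ∃ z w : disc, sym (z, w) = x}

/-- The royal variety `Δ = {(2z, z²) : z ∈ 𝔻}`. -/
def royal : Set (ℂ × ℂ) := {x | ∃ z : disc, x = (2 * (z : ℂ), (z : ℂ) ^ 2)}

/-- The Möbius distance `|φ_z (w)| = |(z - w) / (1 - z̄ w)|`. -/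
def mobiusDist (z w : disc) : ℝ := ‖((involution z) w : ℂ)‖

/-- The leaf `𝓛_c = q⁻¹{c}`, where `q (z₁ + z₂, z₁ z₂) = |φ_{z₁} (z₂)|` on `𝔾`. -/
def leaf (c : ℝ) : Set (ℂ × ℂ) := {x | ∃ z w : disc, sym (z, w) = x ∧ mobiusDist z w = c}

theorem sym_eq_iff {z w z' w' : ℂ} :
    sym (z, w) = sym (z', w') ↔ (z = z' ∧ w = w') ∨ (z = w' ∧ w = z') := by
  simp only [sym, Prod.mk.injEq]
  constructor
  · rintro ⟨h1, h2⟩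
    have h : (z - z') * (z - w') = 0 := by linear_combination z * h1 - h2
    rcases mul_eq_zero.1 h with h | h
    · have hz := sub_eq_zero.1 h
      exact Or.inl ⟨hz, by linear_combination h1 - hz⟩
    · have hz := sub_eq_zero.1 h
      exact Or.inr ⟨hz, by linear_combination h1 - hz⟩
  · rintro (⟨rfl, rfl⟩ | ⟨rfl, rfl⟩)
    · exact ⟨rfl, rfl⟩
    · exact ⟨add_comm _ _, mul_comm _ _⟩

/-- A point of `𝔾` from two points of `𝔻`. -/
def symPt (z w : disc) : symBidisc := ⟨sym (z, w), z, w, rfl⟩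

/-- The automorphism `H_φ (z₁ + z₂, z₁ z₂) = (φ z₁ + φ z₂, φ z₁ φ z₂)` of `𝔾`. -/
def autH (φ : DiscAut) (x : symBidisc) : symBidisc :=
  symPt (φ x.2.choose) (φ x.2.choose_spec.choose)

theorem autH_symPt (φ : DiscAut) (z w : disc) : autH φ (symPt z w) = symPt (φ z) (φ w) := by
  have key : ∀ z' w' : disc, sym (z', w') = sym (z, w) →
      symPt (φ z') (φ w') = symPt (φ z) (φ w) := by
    intro z' w' h
    rcases sym_eq_iff.1 h with ⟨h1, h2⟩ | ⟨h1, h2⟩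
    · rw [Subtype.ext h1, Subtype.ext h2]
    · rw [Subtype.ext h1, Subtype.ext h2]
      exact Subtype.ext (sym_eq_iff.2 (Or.inr ⟨rfl, rfl⟩))
  exact key _ _ (symPt z w).2.choose_spec.choose_spec

theorem exists_symPt (x : symBidisc) : ∃ z w : disc, x = symPt z w := by
  obtain ⟨_, z, w, rfl⟩ := x
  exact ⟨z, w, rfl⟩

/-- `Aut(𝔻)` acts on `𝔾` through the automorphisms `H_φ`. -/
instance : MulAction DiscAut symBidisc where
  smul := autH
  one_smul x := by
    obtain ⟨z, w, rfl⟩ := exists_symPt x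
    exact autH_symPt 1 z w
  mul_smul φ ψ x := by
    obtain ⟨z, w, rfl⟩ := exists_symPt x
    change autH _ _ = autH _ (autH _ _)
    rw [autH_symPt, autH_symPt, autH_symPt]
    rfl

/-- The orbit `[x]` of a point of `𝔾`, as a subset of `ℂ²`. -/
def orbit (x : symBidisc) : Set (ℂ × ℂ) := Subtype.val '' MulAction.orbit DiscAut x

/-- A number `c ∈ (0, 1)` as a point of the disc. -/
def pt (c : Set.Ioo (0 : ℝ) 1) : disc :=
  ⟨((c : ℝ) : ℂ), by
    rw [mem_disc, Complex.norm_real, Real.norm_eq_abs, abs_of_pos c.2.1]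
    exact c.2.2⟩

/-- A manifold structure on `L ⊆ ℂ²`, with the subspace topology, is the structure of a smooth
embedded real three-dimensional submanifold of `ℂ² = ℝ⁴`. -/
def IsSubmanifoldStructure (L : Set (ℂ × ℂ)) (_C : ChartedSpace (EuclideanSpace ℝ (Fin 3)) L) :
    Prop :=
  IsManifold (𝓡 3) ∞ L ∧
    Manifold.IsSmoothEmbedding (𝓡 3) 𝓘(ℝ, ℂ × ℂ) ∞ (Subtype.val : L → ℂ × ℂ)

end

end SymBidisc

open SymBidisc

namespace SymBidisc

noncomputable section

open Set Filter MulAction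

/-! ### Quotient manifolds -/

section Quotient

variable {𝕜 : Type*} [NontriviallyNormedField 𝕜]
  {E : Type*} [NormedAddCommGroup E] [NormedSpace 𝕜 E]
  {H : Type*} [TopologicalSpace H] {I : ModelWithCorners 𝕜 E H} {n : ℕ∞ω}

/-! Orbits: by the Schwarz lemma an automorphism fixing `0` is a rotation, so pairs of points of the
disc are classified up to `Aut(𝔻)` by their Möbius distance (`mobiusDist_map`,
`exists_map_eq_of_mobiusDist_eq`).

Leaves: an unordered pair is `{φ_β(ρ), φ_β(-ρ)}`, where `β` is its hyperbolic midpoint, and `w = ρ²`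
does not depend on the order. The pair `(w, β)` is a real-smooth global coordinate system with range
the bidisc (`midHomeo`). The Möbius distance of the pair is `2|ρ| / (1 + |ρ|²)`, so `𝓛_c` becomes
`{|w| = r²} × 𝔻` with `2r / (1 + r²) = c` (`mem_leaf_iff`). Hence it is an embedded submanifold, cut
out by `log |w|`, and it is diffeomorphic to `S¹ × 𝔻` whatever `c` is (`nonempty_diffeomorph_leaf`).

Quotients: in the coordinates `(λ, α)`, composition with `-id` is `(λ, α) ↦ (-λ, -α)`. The map `(λ,
α) ↦ (λ², -λα)` onto `S¹ × 𝔻` has exactly these orbits as fibres and has smooth local sections, so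
the quotient for `0` is `S¹ × 𝔻` too (`nonempty_diffeomorph_autModZ2_zero`). If `m` is the midpoint
of `0` and `c`, then `φ_c = φ_m ∘ (-id) ∘ φ_m`, and right multiplication by `φ_m` intertwines the
actions for `c` and for `0` (`nonempty_diffeomorph_autModZ2`).

Maps out of the quotients are handled by one principle: two smooth maps with smooth local sections
and the same fibres have diffeomorphic codomains (`nonempty_diffeomorph_of_hasLocalSections`). -/

theorem mem_contDiffGroupoid_of_contMDiffOn (e : OpenPartialHomeomorph H H)
    (h : ContMDiffOn I I n e e.source) (h' : ContMDiffOn I I n e.symm e.target) :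
    e ∈ contDiffGroupoid n I := by
  simp only [contDiffGroupoid, mem_groupoid_of_pregroupoid, contDiffPregroupoid,
    ← contMDiffOn_iff_contDiffOn]
  constructor
  · exact I.contMDiff.comp_contMDiffOn (h.comp (I.contMDiffOn_symm.mono (by simp)) (by simp))
  · exact I.contMDiff.comp_contMDiffOn (h'.comp (I.contMDiffOn_symm.mono (by simp)) (by simp))

/-- One direction is enough, since the inverse of a transition map is again a transition map. -/
theorem isManifold_of_contMDiffOn {M : Type*} [TopologicalSpace M] [ChartedSpace H M]
    (h : ∀ e ∈ atlas H M, ∀ e' ∈ atlas H M,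
      ContMDiffOn I I n (e.symm.trans e') (e.symm.trans e').source) :
    IsManifold I n M where
  compatible {e e'} he he' := by
    refine mem_contDiffGroupoid_of_contMDiffOn _ (h e he e' he') ?_
    have := h e' he' e he
    have e1 : (e.symm.trans e').symm = e'.symm.trans e := by
      rw [OpenPartialHomeomorph.trans_symm_eq_symm_trans_symm, e.symm_symm]
    rwa [← e1] at this

variable {G : Type*} [Group G] {M : Type*} [TopologicalSpace M] [MulAction G M]
  [ProperlyDiscontinuousSMul G M] [ContinuousConstSMul G M] [IsCancelSMul G M]
  [T2Space M] [LocallyCompactSpace M] [ChartedSpace H M]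

variable (G M) in
theorem isLocalHomeomorph_quotientMk :
    IsLocalHomeomorph (Quotient.mk (orbitRel G M)) :=
  isQuotientCoveringMap_quotientMk_of_properlyDiscontinuousSMul.isCoveringMap.isLocalHomeomorph

variable (G) in
-- A local section `σ` picks `σ [x] = g • x` for some `g`. For `y` near `x` the point `g • y` stays
-- in the range of `σ`, on which `σ` inverts the projection; so `σ [y] = g • y` with the same `g`,
-- and the composite is locally the action of `g`.
theorem contMDiffAt_localInverseAt_comp_quotientMk
    (hG : ∀ g : G, ContMDiff I I n (fun x : M => g • x)) (x₀ x : M)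
    (hx : Quotient.mk (orbitRel G M) x ∈
      ((isLocalHomeomorph_quotientMk G M).localInverseAt x₀).source) :
    ContMDiffAt I I n
      ((isLocalHomeomorph_quotientMk G M).localInverseAt x₀ ∘ Quotient.mk (orbitRel G M)) x := by
  set hf := isLocalHomeomorph_quotientMk G M
  set σ := hf.localInverseAt x₀
  obtain ⟨g, hg⟩ : σ (Quotient.mk _ x) ∈ MulAction.orbit G x :=
    orbitRel_apply.1 (Quotient.exact (hf.apply_localInverseAt_of_mem hx))
  refine (hG g).contMDiffAt.congr_of_eventuallyEq ?_
  have hT : ∀ᶠ y in 𝓝 x, g • y ∈ σ.target := by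
    refine (continuous_const_smul g).continuousAt.eventually (σ.open_target.mem_nhds ?_)
    simp only at hg ⊢
    rw [hg]
    exact σ.map_source hx
  filter_upwards [hT] with y hy
  have h1 : σ.symm (g • y) = Quotient.mk _ y := by
    rw [hf.localInverseAt_symm]
    exact Quotient.sound (orbitRel_apply.2 ⟨g, rfl⟩)
  rw [Function.comp_apply, ← h1, σ.right_inv hy]

theorem isManifold_quotient [IsManifold I n M]
    (hG : ∀ g : G, ContMDiff I I n (fun x : M => g • x)) :
    IsManifold I n (orbitRel.Quotient G M) := by
  set hf := isLocalHomeomorph_quotientMk G M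
  refine isManifold_of_contMDiffOn ?_
  rintro _ ⟨q, rfl⟩ _ ⟨q', rfl⟩
  -- The chart at `q` is built on a chosen representative of `q`; compatibility holds for any two
  -- base points, so the choices can be forgotten.
  generalize (Quotient.mk_surjective (s := orbitRel G M)).hasRightInverse.choose q = x
  generalize (Quotient.mk_surjective (s := orbitRel G M)).hasRightInverse.choose q' = x'
  change ContMDiffOn I I n (((hf.localInverseAt x).trans (chartAt H x)).symm.trans
    ((hf.localInverseAt x').trans (chartAt H x'))) _
  intro h hh
  refine ContMDiffAt.contMDiffWithinAt ?_
  simp only [mfld_simps] at hh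
  -- The inverse of a local section is the projection, so the transition map contains the block
  -- "section after projection", which is locally a group element.
  have e : ⇑(((hf.localInverseAt x).trans (chartAt H x)).symm.trans
      ((hf.localInverseAt x').trans (chartAt H x'))) =
      chartAt H x' ∘ (hf.localInverseAt x' ∘ Quotient.mk (orbitRel G M)) ∘ (chartAt H x).symm := by
    simp only [mfld_simps, hf.localInverseAt_symm]
    rfl
  rw [hf.localInverseAt_symm] at hh
  rw [e]
  refine ContMDiffAt.comp h ?_ (ContMDiffAt.comp h
    (contMDiffAt_localInverseAt_comp_quotientMk G hG x' _ hh.2.1) ?_)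
  · exact contMDiffOn_chart.contMDiffAt ((chartAt H x').open_source.mem_nhds hh.2.2)
  · exact contMDiffOn_chart_symm.contMDiffAt ((chartAt H x).open_target.mem_nhds hh.1.1)

/-- The chart at `q = [x]` is a local section `σ` followed by a chart of `M`; read in it, the
projection is that chart of `M` after `σ ∘ mk`, which is smooth. -/
theorem contMDiff_quotientMk [IsManifold I n M]
    (hG : ∀ g : G, ContMDiff I I n (fun x : M => g • x)) :
    ContMDiff I I n (Quotient.mk (orbitRel G M) : M → orbitRel.Quotient G M) := by
  have := isManifold_quotient (I := I) (n := n) hG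
  set hf := isLocalHomeomorph_quotientMk G M
  intro x
  set q : orbitRel.Quotient G M := Quotient.mk (orbitRel G M) x
  set y := (Quotient.mk_surjective (s := orbitRel G M)).hasRightInverse.choose q
  set σ := hf.localInverseAt y
  have hq : q ∈ (σ.trans (chartAt H y)).source := mem_chart_source H q
  have h1 : ContMDiffAt I I n (chartAt H q).symm (chartAt H y (σ q)) :=
    contMDiffOn_chart_symm.contMDiffAt ((chartAt H q).open_target.mem_nhds
      ((chartAt H q).map_source hq))
  have h2 : ContMDiffAt I I n (chartAt H y) (σ q) :=
    contMDiffOn_chart.contMDiffAt ((chartAt H y).open_source.mem_nhds hq.2)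
  have h3 : ContMDiffAt I I n (σ ∘ Quotient.mk (orbitRel G M)) x :=
    contMDiffAt_localInverseAt_comp_quotientMk G hG y x hq.1
  refine (ContMDiffAt.comp x (ContMDiffAt.comp (σ q) h1 h2) h3).congr_of_eventuallyEq ?_
  have hT : ∀ᶠ z in 𝓝 x, Quotient.mk (orbitRel G M) z ∈ (chartAt H q).source :=
    hf.continuous.continuousAt.eventually
      ((chartAt H q).open_source.mem_nhds (mem_chart_source H q))
  filter_upwards [hT] with z hz
  exact ((chartAt H q).left_inv hz).symm

/-- Near `q`, reading a point in the chart at `q` and returning through the chart of `M` gives a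
smooth lift to `M`. The local inverse therefore factors as (local inverse after projection) after
this lift. -/
theorem contMDiffOn_localInverseAt [IsManifold I n M]
    (hG : ∀ g : G, ContMDiff I I n (fun x : M => g • x)) (x : M) :
    ContMDiffOn I I n
      ((isLocalHomeomorph_quotientMk G M).localInverseAt x : orbitRel.Quotient G M → M)
      ((isLocalHomeomorph_quotientMk G M).localInverseAt x).source := by
  have := isManifold_quotient (I := I) (n := n) hG
  set hf := isLocalHomeomorph_quotientMk G M
  intro q hqx
  refine ContMDiffAt.contMDiffWithinAt ?_
  set y := (Quotient.mk_surjective (s := orbitRel G M)).hasRightInverse.choose q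
  set σ := hf.localInverseAt y
  have hc : chartAt H q = σ.trans (chartAt H y) := rfl
  have hq : q ∈ (σ.trans (chartAt H y)).source := mem_chart_source H q
  have h1 : ContMDiffAt I I n (chartAt H y).symm (chartAt H q q) :=
    contMDiffOn_chart_symm.contMDiffAt ((chartAt H y).open_target.mem_nhds
      ((chartAt H y).map_source hq.2))
  have h2 : ContMDiffAt I I n (chartAt H q) q :=
    contMDiffOn_chart.contMDiffAt ((chartAt H q).open_source.mem_nhds hq)
  have e1 : ∀ z ∈ (chartAt H q).source,
      Quotient.mk (orbitRel G M) ((chartAt H y).symm (chartAt H q z)) = z := by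
    intro z hz
    rw [hc] at hz ⊢
    simp only [mfld_simps] at hz ⊢
    rw [(chartAt H y).left_inv hz.2]
    exact hf.apply_localInverseAt_of_mem hz.1
  have h3 := contMDiffAt_localInverseAt_comp_quotientMk (I := I) (n := n) G hG x
    ((chartAt H y).symm (chartAt H q q)) (by rw [e1 q hq]; exact hqx)
  refine (ContMDiffAt.comp q h3 (ContMDiffAt.comp q h1 h2)).congr_of_eventuallyEq ?_
  filter_upwards [(chartAt H q).open_source.mem_nhds hq] with z hz
  simp only [Function.comp_apply]
  rw [e1 z hz]

theorem isLocalDiffeomorph_quotientMk [IsManifold I n M]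
    (hG : ∀ g : G, ContMDiff I I n (fun x : M => g • x)) :
    IsLocalDiffeomorph I I n (Quotient.mk (orbitRel G M) : M → orbitRel.Quotient G M) := by
  intro x
  set hf := isLocalHomeomorph_quotientMk G M
  refine ⟨{ toPartialEquiv := (hf.localInverseAt x).symm.toPartialEquiv
            open_source := (hf.localInverseAt x).open_target
            open_target := (hf.localInverseAt x).open_source
            contMDiffOn_toFun := ?_
            contMDiffOn_invFun := contMDiffOn_localInverseAt hG x },
    hf.self_mem_localInverseAt_target, ?_⟩
  · change ContMDiffOn I I n (hf.localInverseAt x).symm _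
    rw [hf.localInverseAt_symm]
    exact (contMDiff_quotientMk hG).contMDiffOn
  · intro z _
    exact (congrFun (hf.localInverseAt_symm x) z).symm

end Quotient

/-! ### Smooth maps with local sections -/

section Sections

variable {𝕜 : Type*} [NontriviallyNormedField 𝕜]
  {E : Type*} [NormedAddCommGroup E] [NormedSpace 𝕜 E]
  {H : Type*} [TopologicalSpace H] {I : ModelWithCorners 𝕜 E H}
  {E' : Type*} [NormedAddCommGroup E'] [NormedSpace 𝕜 E']
  {H' : Type*} [TopologicalSpace H'] {I' : ModelWithCorners 𝕜 E' H'}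
  {E'' : Type*} [NormedAddCommGroup E''] [NormedSpace 𝕜 E'']
  {H'' : Type*} [TopologicalSpace H''] {I'' : ModelWithCorners 𝕜 E'' H''} {n : ℕ∞ω}
  {M : Type*} [TopologicalSpace M] [ChartedSpace H M]
  {N : Type*} [TopologicalSpace N] [ChartedSpace H' N]
  {P : Type*} [TopologicalSpace P] [ChartedSpace H'' P]

variable (I I' n) in
/-- A `C^n` map with a `C^n` local section around each point of its codomain. -/
def HasLocalSections (f : M → N) : Prop :=
  ContMDiff I I' n f ∧
    ∀ y : N, ∃ s : N → M, ContMDiffAt I' I n s y ∧ ∀ᶠ z in 𝓝 y, f (s z) = z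

theorem HasLocalSections.surjective {f : M → N} (hf : HasLocalSections I I' n f) :
    Function.Surjective f := fun y =>
  let ⟨s, _, hs⟩ := hf.2 y
  ⟨s y, hs.self_of_nhds⟩

theorem _root_.IsLocalDiffeomorph.hasLocalSections {f : M → N}
    (hf : IsLocalDiffeomorph I I' n f) (hs : Function.Surjective f) :
    HasLocalSections I I' n f := by
  refine ⟨hf.contMDiff, fun y => ?_⟩
  obtain ⟨x, rfl⟩ := hs y
  exact ⟨(hf x).localInverse, (hf x).localInverse_contMDiffAt,
    (hf x).localInverse_eventuallyEq_right⟩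

/-- Locally `h = (h ∘ f) ∘ s` for a smooth section `s` of `f`. -/
theorem HasLocalSections.contMDiff_of_comp {f : M → N} (hf : HasLocalSections I I' n f)
    {h : N → P} (hh : ContMDiff I I'' n (h ∘ f)) : ContMDiff I' I'' n h := by
  intro y
  obtain ⟨s, hs, hs'⟩ := hf.2 y
  refine (hh.contMDiffAt.comp y hs).congr_of_eventuallyEq ?_
  filter_upwards [hs'] with z hz
  simp only [Function.comp_apply, hz]

/-- Two maps with local sections and the same fibres have diffeomorphic codomains. -/
theorem nonempty_diffeomorph_of_hasLocalSections {f : M → N} {g : M → P}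
    (hf : HasLocalSections I I' n f) (hg : HasLocalSections I I'' n g)
    (h : ∀ x y, f x = f y ↔ g x = g y) : Nonempty (Diffeomorph I' I'' N P n) := by
  obtain ⟨s, hs⟩ := hf.surjective.hasRightInverse
  obtain ⟨t, ht⟩ := hg.surjective.hasRightInverse
  -- The sections `s` and `t` are only set-theoretic. Equality of fibres makes `g ∘ s` and `f ∘ t`
  -- independent of their choice, and smoothness descends along `f` and `g`.
  have h1 : (g ∘ s) ∘ f = g := funext fun x => (h _ _).1 (hs _)
  have h2 : (f ∘ t) ∘ g = f := funext fun x => (h _ _).2 (ht _)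
  refine ⟨{ toFun := g ∘ s, invFun := f ∘ t, left_inv := fun y => ?_, right_inv := fun y => ?_,
            contMDiff_toFun := hf.contMDiff_of_comp (show ContMDiff I I'' n ((g ∘ s) ∘ f) by rw [h1]; exact hg.1),
            contMDiff_invFun := hg.contMDiff_of_comp (show ContMDiff I I' n ((f ∘ t) ∘ g) by rw [h2]; exact hf.1) }⟩
  · rw [Function.comp_apply, Function.comp_apply, (h _ _).2 (ht _), hs]
  · rw [Function.comp_apply, Function.comp_apply, (h _ _).1 (hs _), ht]

end Sections

/-! ### Slice charts -/

section Slice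

variable {E F E' : Type*} [NormedAddCommGroup E] [NormedSpace ℝ E]
  [NormedAddCommGroup F] [NormedSpace ℝ F] [NormedAddCommGroup E'] [NormedSpace ℝ E']

/-- `ψ` is a `C^n` chart of the ambient space in which `L` is given by the vanishing of the second
component. -/
structure IsSliceChart (n : ℕ∞ω) (L : Set E') (ψ : OpenPartialHomeomorph E' (E × F)) : Prop where
  contDiffOn : ContDiffOn ℝ n ψ ψ.source
  contDiffOn_symm : ContDiffOn ℝ n ψ.symm ψ.target
  mem_iff : ∀ y ∈ ψ.source, y ∈ L ↔ (ψ y).2 = 0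

open scoped Classical in
/-- The chart of `L` induced by a slice chart. -/
def IsSliceChart.chart {n : ℕ∞ω} {L : Set E'} {ψ : OpenPartialHomeomorph E' (E × F)}
    (h : IsSliceChart n L ψ) (x₀ : L) : OpenPartialHomeomorph L E where
  toFun y := (ψ y).1
  -- The value `x₀` only makes the function total: on the target the point always lies in `L`.
  invFun v := if hv : ψ.symm (v, 0) ∈ L then ⟨_, hv⟩ else x₀
  source := Subtype.val ⁻¹' ψ.source
  target := {v | (v, 0) ∈ ψ.target}
  map_source' y hy := by
    have h0 := (h.mem_iff y hy).1 y.2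
    have : ψ y = ((ψ y).1, 0) := Prod.ext rfl h0
    exact this ▸ ψ.map_source hy
  map_target' v hv := by
    have hs := ψ.map_target hv
    have hL : ψ.symm (v, 0) ∈ L := (h.mem_iff _ hs).2 (by rw [ψ.right_inv hv])
    rw [dif_pos hL]
    exact hs
  left_inv' y hy := by
    have h0 := (h.mem_iff y hy).1 y.2
    have h1 : ψ y = ((ψ y).1, 0) := Prod.ext rfl h0
    have h2 : ψ.symm ((ψ y).1, 0) = y := by rw [← h1, ψ.left_inv hy]
    apply Subtype.ext
    rw [dif_pos (by rw [h2]; exact y.2)]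
    exact h2
  right_inv' v hv := by
    have hs := ψ.map_target hv
    have hL : ψ.symm (v, 0) ∈ L := (h.mem_iff _ hs).2 (by rw [ψ.right_inv hv])
    rw [dif_pos hL]
    simp only
    rw [ψ.right_inv hv]
  open_source := ψ.open_source.preimage continuous_subtype_val
  open_target := ψ.open_target.preimage (by fun_prop : Continuous fun v : E => (v, (0 : F)))
  continuousOn_toFun :=
    (continuous_fst.comp_continuousOn ψ.continuousOn).comp continuous_subtype_val.continuousOn
      fun _ hy => hy
  continuousOn_invFun := by
    rw [continuousOn_iff_continuous_domRestrict]
    refine continuous_induced_rng.2 ?_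
    have : Continuous (Set.domRestrict {v : E | (v, (0 : F)) ∈ ψ.target} fun v => ψ.symm (v, 0)) :=
      continuousOn_iff_continuous_domRestrict.1 (ψ.continuousOn_symm.comp
        (by fun_prop : Continuous fun v : E => (v, (0 : F))).continuousOn fun _ hy => hy)
    refine this.congr fun v => ?_
    have hs := ψ.map_target v.2
    have hL : ψ.symm ((v : E), 0) ∈ L := (h.mem_iff _ hs).2 (by rw [ψ.right_inv v.2])
    simp only [Function.comp_apply, Set.domRestrict_apply, dif_pos hL]

theorem IsSliceChart.coe_chart_symm {n : ℕ∞ω} {L : Set E'} {ψ : OpenPartialHomeomorph E' (E × F)}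
    (h : IsSliceChart n L ψ) (x₀ : L) {v : E} (hv : (v, 0) ∈ ψ.target) :
    ((h.chart x₀).symm v : E') = ψ.symm (v, 0) := by
  have hs := ψ.map_target hv
  have hL : ψ.symm (v, 0) ∈ L := (h.mem_iff _ hs).2 (by rw [ψ.right_inv hv])
  classical
  change Subtype.val (if hv : ψ.symm (v, 0) ∈ L then (⟨_, hv⟩ : L) else x₀) = _
  rw [dif_pos hL]

/-- The transition maps between slices are the ambient ones restricted to `F`-coordinate `0`, and in
a slice chart the inclusion reads `v ↦ (v, 0)`, the normal form of an immersion. The map `e` returns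
the values of the slice charts to `E'`, the model space of the ambient manifold. -/
theorem exists_submanifold_of_slices {n : ℕ∞ω} (e : (E × F) ≃L[ℝ] E') (L : Set E')
    (h : ∀ x ∈ L, ∃ ψ : OpenPartialHomeomorph E' (E × F), x ∈ ψ.source ∧ IsSliceChart n L ψ) :
    ∃ _ : ChartedSpace E L, IsManifold 𝓘(ℝ, E) n L ∧
      Manifold.IsSmoothEmbedding 𝓘(ℝ, E) 𝓘(ℝ, E') n (Subtype.val : L → E') := by
  choose ψ hψ hs using fun x : L => h x x.2
  let C : ChartedSpace E L :=
    { atlas := range fun x => (hs x).chart x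
      chartAt := fun x => (hs x).chart x
      mem_chart_source := hψ
      chart_mem_atlas := fun x => ⟨x, rfl⟩ }
  have hM : IsManifold 𝓘(ℝ, E) n L := by
    refine isManifold_of_contMDiffOn ?_
    rintro _ ⟨x, rfl⟩ _ ⟨y, rfl⟩
    rw [contMDiffOn_iff_contDiffOn]
    intro v hv
    refine ContDiffAt.contDiffWithinAt ?_
    have hv1 : (v, 0) ∈ (ψ x).target := hv.1
    have hv2 : (ψ x).symm (v, 0) ∈ (ψ y).source := by
      rw [← (hs x).coe_chart_symm x hv1]
      exact hv.2
    have h1 : ContDiffAt ℝ n (fun v => (ψ y ((ψ x).symm (v, 0))).1) v := by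
      refine contDiff_fst.contDiffAt.comp v (ContDiffAt.comp v
        ((hs y).contDiffOn.contDiffAt ((ψ y).open_source.mem_nhds hv2))
        (ContDiffAt.comp v ((hs x).contDiffOn_symm.contDiffAt
          ((ψ x).open_target.mem_nhds hv1)) (by fun_prop)))
    refine h1.congr_of_eventuallyEq ?_
    filter_upwards [((hs x).chart x).open_target.mem_nhds hv1] with w hw
    change (ψ y (((hs x).chart x).symm w)).1 = _
    rw [(hs x).coe_chart_symm x hw]
  refine ⟨C, hM, ?_, Topology.IsEmbedding.subtypeVal⟩
  refine Manifold.IsImmersionOfComplement.isImmersion (F := F) fun x => ?_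
  refine Manifold.IsImmersionAtOfComplement.mk_of_continuousAt
    continuous_subtype_val.continuousAt e ((hs x).chart x)
    ((ψ x).trans e.toHomeomorph.toOpenPartialHomeomorph) (hψ x) (by simpa using hψ x)
    (IsManifold.chart_mem_maximalAtlas x) ?_ ?_
  · refine OpenPartialHomeomorph.mem_maximalAtlas_of_contMDiffOn _ ?_ ?_
    · rw [contMDiffOn_iff_contDiffOn]
      exact e.contDiff.comp_contDiffOn ((hs x).contDiffOn.mono (by simp))
    · rw [contMDiffOn_iff_contDiffOn]
      exact (hs x).contDiffOn_symm.comp e.symm.contDiff.contDiffOn fun v hv => by simpa using hv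
  · intro v hv
    have hv' : (v, 0) ∈ (ψ x).target := by
      simp only [mfld_simps] at hv
      exact hv
    change e (ψ x (((hs x).chart x).symm v)) = e (v, 0)
    rw [(hs x).coe_chart_symm x hv', (ψ x).right_inv hv']

end Slice

/-! ### Orbits of `Aut(𝔻)` on `𝔾` -/

theorem involution_self (a : disc) : involution a a = 0 :=
  Subtype.ext (mobius_self (-1) a)

theorem involution_involution (a z : disc) : involution a (involution a z) = z := by
  rw [← DiscAut.mul_apply, involution_mul_self]; rfl

theorem involution_zero (a : disc) : involution a 0 = a := by
  rw [← involution_self a, involution_involution]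

/-- The composite `φ_{φ(z)} ∘ φ ∘ φ_z` fixes `0`, hence is a rotation; evaluating it at `φ_z(w)`
compares the two distances. -/
theorem mobiusDist_map (φ : DiscAut) (z w : disc) :
    mobiusDist (φ z) (φ w) = mobiusDist z w := by
  have h0 : (((involution (φ z) * φ * involution z) 0 : disc) : ℂ) = 0 := by
    rw [DiscAut.mul_apply, DiscAut.mul_apply, involution_zero, involution_self]; rfl
  obtain ⟨lam, hlam⟩ := rotation_of_fix _ h0
  have h := hlam (involution z w)
  rw [DiscAut.mul_apply, DiscAut.mul_apply, involution_involution] at h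
  rw [mobiusDist, h, norm_mul, Circle.norm_coe, one_mul, mobiusDist]

theorem mobiusDist_pos {z w : disc} (h : z ≠ w) : 0 < mobiusDist z w := by
  rw [mobiusDist, involution_apply, norm_pos_iff]
  exact div_ne_zero (sub_ne_zero.2 fun h' => h (Subtype.ext h'))
    (one_sub_ne_zero (disc_norm_lt z) (disc_norm_lt w))

theorem mobiusDist_lt_one (z w : disc) : mobiusDist z w < 1 := disc_norm_lt _

theorem exists_circle_mul_eq {u v : ℂ} (h : ‖u‖ = ‖v‖) : ∃ lam : Circle, lam * u = v := by
  by_cases hu : u = 0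
  · refine ⟨1, ?_⟩
    rw [hu, norm_zero, eq_comm, norm_eq_zero] at h
    rw [hu, h, mul_zero]
  · refine ⟨⟨v / u, ?_⟩, div_mul_cancel₀ v hu⟩
    change _ ∈ Metric.sphere (0 : ℂ) 1
    rw [mem_sphere_zero_iff_norm, norm_div, h, div_self]
    rwa [← h, norm_ne_zero_iff]

/-- Move `z` to `0` by `φ_z`, rotate `φ_z(w)` onto `φ_{z'}(w')`, and move `0` to `z'` by `φ_{z'}`.
-/
theorem exists_map_eq_of_mobiusDist_eq {z w z' w' : disc}
    (h : mobiusDist z w = mobiusDist z' w') : ∃ φ : DiscAut, φ z = z' ∧ φ w = w' := by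
  obtain ⟨lam, hlam⟩ := exists_circle_mul_eq h
  refine ⟨involution z' * mobius lam 0 * involution z, ?_, ?_⟩
  · rw [DiscAut.mul_apply, DiscAut.mul_apply, involution_self]
    rw [show mobius lam 0 0 = 0 from Subtype.ext (mobius_self lam 0), involution_zero]
  · rw [DiscAut.mul_apply, DiscAut.mul_apply]
    rw [show mobius lam 0 (involution z w) = involution z' w' from Subtype.ext (by
      rw [mobius_apply, ← hlam, disc_coe_zero]; simp), involution_involution]

theorem mem_orbit_symPt {z w : disc} {x : ℂ × ℂ} :
    x ∈ orbit (symPt z w) ↔ ∃ φ : DiscAut, sym ((φ z : ℂ), (φ w : ℂ)) = x := by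
  constructor
  · rintro ⟨_, ⟨φ, rfl⟩, rfl⟩
    exact ⟨φ, congrArg Subtype.val (autH_symPt φ z w).symm⟩
  · rintro ⟨φ, rfl⟩
    exact ⟨_, ⟨φ, rfl⟩, congrArg Subtype.val (autH_symPt φ z w)⟩

theorem orbit_symPt (z w : disc) : orbit (symPt z w) = leaf (mobiusDist z w) := by
  ext x
  rw [mem_orbit_symPt]
  constructor
  · rintro ⟨φ, rfl⟩
    exact ⟨φ z, φ w, rfl, mobiusDist_map φ z w⟩
  · rintro ⟨z', w', rfl, h⟩
    obtain ⟨φ, rfl, rfl⟩ := exists_map_eq_of_mobiusDist_eq h.symm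
    exact ⟨φ, rfl⟩

theorem leaf_eq_orbit (c : Ioo (0 : ℝ) 1) : leaf c = orbit (symPt (pt c) 0) := by
  rw [orbit_symPt, mobiusDist, involution_zero, pt, Complex.norm_real, Real.norm_eq_abs,
    abs_of_pos c.2.1]

theorem exists_orbit_eq_leaf (x : symBidisc) (hx : (x : ℂ × ℂ) ∉ royal) :
    ∃ c : Ioo (0 : ℝ) 1, orbit x = leaf c := by
  obtain ⟨z, w, rfl⟩ := exists_symPt x
  have hzw : z ≠ w := by
    rintro rfl
    refine hx ⟨z, ?_⟩
    change sym (z, z) = _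
    rw [sym, two_mul, sq]
  exact ⟨⟨mobiusDist z w, mobiusDist_pos hzw, mobiusDist_lt_one z w⟩, orbit_symPt z w⟩

/-! ### The pseudo-hyperbolic midpoint -/

/-- The point halfway between `0` and `A` for the hyperbolic metric of the disc. -/
def halfPt (A : ℂ) : ℂ := A / ((1 + √(1 - ‖A‖ ^ 2) : ℝ) : ℂ)

/-- The point whose hyperbolic midpoint with `0` is `β`. -/
def doublePt (β : ℂ) : ℂ := 2 * β / (1 + β * conj β)

theorem one_add_mul_conj (β : ℂ) : 1 + β * conj β = ((1 + ‖β‖ ^ 2 : ℝ) : ℂ) := by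
  rw [Complex.mul_conj, Complex.normSq_eq_norm_sq]; push_cast; rfl

theorem one_add_mul_conj_ne_zero (β : ℂ) : 1 + β * conj β ≠ 0 := by
  rw [one_add_mul_conj, Complex.ofReal_ne_zero]
  positivity

theorem norm_doublePt (β : ℂ) : ‖doublePt β‖ = 2 * ‖β‖ / (1 + ‖β‖ ^ 2) := by
  rw [doublePt, one_add_mul_conj, norm_div, norm_mul, Complex.norm_real, Real.norm_eq_abs,
    abs_of_pos (by positivity)]
  simp

theorem norm_doublePt_lt {β : ℂ} (h : ‖β‖ < 1) : ‖doublePt β‖ < 1 := by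
  rw [norm_doublePt, div_lt_one (by positivity)]
  nlinarith [sq_nonneg (1 - ‖β‖)]

theorem one_add_sqrt_pos (t : ℝ) : 0 < 1 + √t := by positivity

theorem norm_halfPt (A : ℂ) : ‖halfPt A‖ = ‖A‖ / (1 + √(1 - ‖A‖ ^ 2)) := by
  rw [halfPt, norm_div, Complex.norm_real, Real.norm_eq_abs, abs_of_pos (one_add_sqrt_pos _)]

theorem norm_halfPt_lt {A : ℂ} (h : ‖A‖ < 1) : ‖halfPt A‖ < 1 := by
  rw [norm_halfPt, div_lt_one (one_add_sqrt_pos _)]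
  linarith [Real.sqrt_nonneg (1 - ‖A‖ ^ 2)]

theorem doublePt_halfPt {A : ℂ} (h : ‖A‖ < 1) : doublePt (halfPt A) = A := by
  have hp := one_add_sqrt_pos (1 - ‖A‖ ^ 2)
  have hs : √(1 - ‖A‖ ^ 2) ^ 2 = 1 - ‖A‖ ^ 2 :=
    Real.sq_sqrt (by nlinarith [norm_nonneg A])
  -- With `s = √(1 - |A|²)`, this is `(1 + s)² + |A|² = 2 (1 + s)`.
  have e : (1 : ℝ) + ‖halfPt A‖ ^ 2 = 2 / (1 + √(1 - ‖A‖ ^ 2)) := by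
    rw [norm_halfPt]
    field_simp
    linear_combination hs
  rw [doublePt, one_add_mul_conj, e, halfPt]
  have hp' : ((1 + √(1 - ‖A‖ ^ 2) : ℝ) : ℂ) ≠ 0 := Complex.ofReal_ne_zero.2 hp.ne'
  rw [Complex.ofReal_div, Complex.ofReal_ofNat]
  field_simp

theorem halfPt_doublePt {β : ℂ} (h : ‖β‖ < 1) : halfPt (doublePt β) = β := by
  have hb := norm_nonneg β
  -- From `(1 + t)² - 4t = (1 - t)²` with `t = |β|²`; the condition `|β| < 1` selects the positive
  -- root.
  have e : √(1 - ‖doublePt β‖ ^ 2) = (1 - ‖β‖ ^ 2) / (1 + ‖β‖ ^ 2) := by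
    rw [Real.sqrt_eq_iff_mul_self_eq_of_pos, norm_doublePt]
    · field_simp
      ring
    · have : 0 < 1 - ‖β‖ ^ 2 := by nlinarith
      positivity
  have e2 : 1 + √(1 - ‖doublePt β‖ ^ 2) = 2 / (1 + ‖β‖ ^ 2) := by
    rw [e]
    field_simp
    ring
  have hp : ((1 + ‖β‖ ^ 2 : ℝ) : ℂ) ≠ 0 := Complex.ofReal_ne_zero.2 (by positivity)
  rw [halfPt, e2, doublePt, one_add_mul_conj, Complex.ofReal_div, Complex.ofReal_ofNat]
  field_simp

/-! ### Global smooth coordinates on `𝔾` -/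

theorem norm_moebius_lt {b z : ℂ} (hb : ‖b‖ < 1) (hz : ‖z‖ < 1) :
    ‖(b - z) / (1 - conj b * z)‖ < 1 := by
  have := disc_norm_lt (involution ⟨b, mem_disc.2 hb⟩ ⟨z, mem_disc.2 hz⟩)
  rwa [involution_apply] at this

theorem moebius_moebius {b z : ℂ} (hb : ‖b‖ < 1) (hz : ‖z‖ < 1) :
    (b - (b - z) / (1 - conj b * z)) / (1 - conj b * ((b - z) / (1 - conj b * z))) = z := by
  have := congrArg Subtype.val (involution_involution ⟨b, mem_disc.2 hb⟩ ⟨z, mem_disc.2 hz⟩)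
  rwa [involution_apply, involution_apply] at this

theorem norm_sq_lt_one {b : ℂ} (hb : ‖b‖ < 1) : ‖b ^ 2‖ < 1 := by
  rw [norm_pow]
  exact pow_lt_one₀ (norm_nonneg b) hb two_ne_zero

theorem one_sub_mul_conj (p : ℂ) : 1 - p * conj p = ((1 - ‖p‖ ^ 2 : ℝ) : ℂ) := by
  rw [Complex.mul_conj, Complex.normSq_eq_norm_sq]; push_cast; rfl

/-- The centre `A` of the involution `φ_A` of the disc exchanging `z₁` and `z₂`, as a function
of `(z₁ + z₂, z₁ z₂)`. -/
def centre (x : ℂ × ℂ) : ℂ := (x.1 - x.2 * conj x.1) / (1 - x.2 * conj x.2)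

/-- The coordinates `(w, β)` of a point of `𝔾`: `β` is the hyperbolic midpoint of the two points
of the disc, and they are `φ_β (± ρ)` with `ρ ^ 2 = w`. -/
def midCoord (x : ℂ × ℂ) : ℂ × ℂ :=
  ((halfPt (centre x) ^ 2 - x.2) / (1 - conj (halfPt (centre x) ^ 2) * x.2), halfPt (centre x))

/-- The point of `𝔾` with coordinates `(w, β)`. -/
def ofMidCoord (y : ℂ × ℂ) : ℂ × ℂ :=
  (doublePt y.2 + conj (doublePt y.2) * ((y.2 ^ 2 - y.1) / (1 - conj (y.2 ^ 2) * y.1)),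
    (y.2 ^ 2 - y.1) / (1 - conj (y.2 ^ 2) * y.1))

/-- The domain of the coordinates `(w, β)`. -/
def midSource : Set (ℂ × ℂ) := {x | ‖x.2‖ < 1 ∧ ‖x.1 - x.2 * conj x.1‖ < 1 - ‖x.2‖ ^ 2}

/-- The range of the coordinates `(w, β)`. -/
def midTarget : Set (ℂ × ℂ) := {y | ‖y.1‖ < 1 ∧ ‖y.2‖ < 1}

theorem isOpen_midSource : IsOpen midSource := by
  have h : Continuous fun x : ℂ × ℂ => conj x.1 := Complex.continuous_conj.comp continuous_fst
  exact IsOpen.and (isOpen_lt (by fun_prop) (by fun_prop)) (isOpen_lt (by fun_prop) (by fun_prop))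

theorem isOpen_midTarget : IsOpen midTarget :=
  IsOpen.and (isOpen_lt (by fun_prop) (by fun_prop)) (isOpen_lt (by fun_prop) (by fun_prop))

theorem one_sub_mul_conj_ne_zero {p : ℂ} (hp : ‖p‖ < 1) : 1 - p * conj p ≠ 0 := by
  rw [mul_comm]
  exact one_sub_ne_zero hp hp

/-- The second inequality defining `midSource` is `|A| < 1` for the centre `A`, cleared of its
denominator. -/
theorem norm_centre_lt {x : ℂ × ℂ} (hx : x ∈ midSource) : ‖centre x‖ < 1 := by
  have h1 : 0 < 1 - ‖x.2‖ ^ 2 := lt_of_le_of_lt (norm_nonneg _) hx.2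
  rw [centre, one_sub_mul_conj, norm_div, Complex.norm_real, Real.norm_eq_abs, abs_of_pos h1,
    div_lt_one h1]
  exact hx.2

/-- Clearing denominators in `φ_A(z₁) = z₂` gives `z₁ + z₂ = A + Ā z₁z₂`. Together with its
conjugate this is a linear system for `A` and `Ā` of determinant `1 - |p|²`, where `p = z₁z₂`;
`centre` is its solution. -/
theorem centre_add {p : ℂ} (hp : ‖p‖ < 1) (A : ℂ) : centre (A + conj A * p, p) = A := by
  have h := one_sub_mul_conj_ne_zero hp
  rw [centre, div_eq_iff h]
  simp only [map_add, map_mul, Complex.conj_conj]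
  ring

theorem add_centre {x : ℂ × ℂ} (hx : ‖x.2‖ < 1) :
    centre x + conj (centre x) * x.2 = x.1 := by
  have h := one_sub_mul_conj_ne_zero hx
  have h' : 1 - conj x.2 * x.2 ≠ 0 := one_sub_ne_zero hx hx
  rw [centre]
  simp only [map_div₀, map_sub, map_mul, map_one, Complex.conj_conj]
  rw [show 1 - conj x.2 * x.2 = 1 - x.2 * conj x.2 by ring, div_mul_eq_mul_div, ← add_div,
    div_eq_iff h]
  ring

theorem ofMidCoord_mem {y : ℂ × ℂ} (hy : y ∈ midTarget) : ofMidCoord y ∈ midSource := by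
  have hp : ‖(ofMidCoord y).2‖ < 1 := norm_moebius_lt (norm_sq_lt_one hy.2) hy.1
  have hc : centre (ofMidCoord y) = doublePt y.2 := centre_add hp _
  refine ⟨hp, ?_⟩
  have h1 : 0 < 1 - ‖(ofMidCoord y).2‖ ^ 2 := by nlinarith [norm_nonneg (ofMidCoord y).2]
  have h2 := norm_doublePt_lt hy.2
  rw [← hc, centre, one_sub_mul_conj, norm_div, Complex.norm_real, Real.norm_eq_abs,
    abs_of_pos h1, div_lt_one h1] at h2
  exact h2

theorem midCoord_mem {x : ℂ × ℂ} (hx : x ∈ midSource) : midCoord x ∈ midTarget := by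
  have h := norm_halfPt_lt (norm_centre_lt hx)
  exact ⟨norm_moebius_lt (norm_sq_lt_one h) hx.1, h⟩

/-- The product `φ_β(ρ) φ_β(-ρ)` equals `φ_b(w)` with `b = β²`, so the same involution turns `w`
into `z₁z₂` and back; the centre is recovered by `centre_add` and then halved. -/
theorem midCoord_ofMidCoord {y : ℂ × ℂ} (hy : y ∈ midTarget) : midCoord (ofMidCoord y) = y := by
  have hp : ‖(ofMidCoord y).2‖ < 1 := norm_moebius_lt (norm_sq_lt_one hy.2) hy.1
  have hc : centre (ofMidCoord y) = doublePt y.2 := centre_add hp _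
  rw [midCoord, hc, halfPt_doublePt hy.2]
  exact Prod.ext (moebius_moebius (norm_sq_lt_one hy.2) hy.1) rfl

theorem ofMidCoord_midCoord {x : ℂ × ℂ} (hx : x ∈ midSource) : ofMidCoord (midCoord x) = x := by
  have hA := norm_centre_lt hx
  have hp : (ofMidCoord (midCoord x)).2 = x.2 :=
    moebius_moebius (norm_sq_lt_one (norm_halfPt_lt hA)) hx.1
  refine Prod.ext ?_ hp
  change doublePt (halfPt (centre x)) + conj (doublePt (halfPt (centre x))) *
    (ofMidCoord (midCoord x)).2 = x.1
  rw [hp, doublePt_halfPt hA, add_centre hx.1]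

theorem contDiff_conj {n : ℕ∞ω} : ContDiff ℝ n (fun z : ℂ => conj z) :=
  Complex.conjCLE.contDiff

theorem contDiffAt_div {V : Type*} [NormedAddCommGroup V] [NormedSpace ℝ V] {n : ℕ∞ω} {f g : V → ℂ}
    {x : V} (hf : ContDiffAt ℝ n f x) (hg : ContDiffAt ℝ n g x) (h : g x ≠ 0) :
    ContDiffAt ℝ n (fun v => f v / g v) x := by
  simp only [div_eq_mul_inv]
  exact hf.mul (hg.inv h)

theorem contDiffAt_moebius {V : Type*} [NormedAddCommGroup V] [NormedSpace ℝ V] {n : ℕ∞ω}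
    {b z : V → ℂ} {x : V} (hb : ContDiffAt ℝ n b x) (hz : ContDiffAt ℝ n z x)
    (hb' : ‖b x‖ < 1) (hz' : ‖z x‖ < 1) :
    ContDiffAt ℝ n (fun v => (b v - z v) / (1 - conj (b v) * z v)) x :=
  contDiffAt_div (hb.sub hz)
    (contDiffAt_const.sub ((contDiff_conj.contDiffAt.comp x hb).mul hz)) (one_sub_ne_zero hb' hz')

theorem contDiffAt_centre {n : ℕ∞ω} {x : ℂ × ℂ} (hx : ‖x.2‖ < 1) : ContDiffAt ℝ n centre x := by
  have h1 : ContDiff ℝ n fun x : ℂ × ℂ => conj x.1 := contDiff_conj.comp contDiff_fst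
  have h2 : ContDiff ℝ n fun x : ℂ × ℂ => conj x.2 := contDiff_conj.comp contDiff_snd
  exact contDiffAt_div (contDiff_fst.sub (contDiff_snd.mul h1)).contDiffAt
    (contDiff_const.sub (contDiff_snd.mul h2)).contDiffAt (one_sub_mul_conj_ne_zero hx)

theorem contDiffAt_halfPt {n : ℕ∞ω} {A : ℂ} (hA : ‖A‖ < 1) : ContDiffAt ℝ n halfPt A := by
  have h1 : ContDiffAt ℝ n (fun A : ℂ => 1 + √(1 - ‖A‖ ^ 2)) A := by
    refine contDiffAt_const.add (ContDiffAt.sqrt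
      (contDiffAt_const.sub (contDiff_norm_sq ℝ).contDiffAt) ?_)
    have : 0 < 1 - ‖A‖ ^ 2 := by nlinarith [norm_nonneg A]
    exact this.ne'
  exact contDiffAt_div contDiffAt_id (Complex.ofRealCLM.contDiff.contDiffAt.comp A h1)
    (Complex.ofReal_ne_zero.2 (one_add_sqrt_pos _).ne')

theorem contDiff_doublePt {n : ℕ∞ω} : ContDiff ℝ n doublePt := by
  refine contDiff_iff_contDiffAt.2 fun β => contDiffAt_div ?_ ?_ (one_add_mul_conj_ne_zero β)
  · exact (contDiff_const.mul contDiff_id).contDiffAt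
  · exact (contDiff_const.add (contDiff_id.mul contDiff_conj)).contDiffAt

theorem contDiffOn_midCoord {n : ℕ∞ω} : ContDiffOn ℝ n midCoord midSource := by
  intro x hx
  refine ContDiffAt.contDiffWithinAt ?_
  have hA := norm_centre_lt hx
  have h : ContDiffAt ℝ n (fun x => halfPt (centre x)) x :=
    (contDiffAt_halfPt hA).comp x (contDiffAt_centre hx.1)
  exact (contDiffAt_moebius (h.pow 2) contDiffAt_snd (norm_sq_lt_one (norm_halfPt_lt hA))
    hx.1).prodMk h

theorem contDiffOn_ofMidCoord {n : ℕ∞ω} : ContDiffOn ℝ n ofMidCoord midTarget := by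
  intro y hy
  refine ContDiffAt.contDiffWithinAt ?_
  have h1 : ContDiff ℝ n (fun y : ℂ × ℂ => doublePt y.2) := contDiff_doublePt.comp contDiff_snd
  have h2 : ContDiff ℝ n (fun y : ℂ × ℂ => conj (doublePt y.2)) := contDiff_conj.comp h1
  have h3 : ContDiffAt ℝ n
      (fun y : ℂ × ℂ => (y.2 ^ 2 - y.1) / (1 - conj (y.2 ^ 2) * y.1)) y :=
    contDiffAt_moebius (contDiffAt_snd.pow 2) contDiffAt_fst (norm_sq_lt_one hy.2) hy.1
  exact (h1.contDiffAt.add (h2.contDiffAt.mul h3)).prodMk h3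

/-- The global coordinates `(w, β)` as an open partial homeomorphism. -/
def midHomeo : OpenPartialHomeomorph (ℂ × ℂ) (ℂ × ℂ) where
  toFun := midCoord
  invFun := ofMidCoord
  source := midSource
  target := midTarget
  map_source' _ := midCoord_mem
  map_target' _ := ofMidCoord_mem
  left_inv' _ := ofMidCoord_midCoord
  right_inv' _ := midCoord_ofMidCoord
  open_source := isOpen_midSource
  open_target := isOpen_midTarget
  continuousOn_toFun := (contDiffOn_midCoord (n := 0)).continuousOn
  continuousOn_invFun := (contDiffOn_ofMidCoord (n := 0)).continuousOn

/-! ### The leaves in coordinates -/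

/-- The radius `r` with `2 r / (1 + r ^ 2) = c`. -/
def radius (c : Ioo (0 : ℝ) 1) : ℝ := c / (1 + √(1 - (c : ℝ) ^ 2))

theorem radius_eq (c : Ioo (0 : ℝ) 1) : ((radius c : ℝ) : ℂ) = halfPt (c : ℝ) := by
  rw [radius, halfPt, Complex.norm_real, Real.norm_eq_abs, sq_abs, Complex.ofReal_div]

theorem radius_pos (c : Ioo (0 : ℝ) 1) : 0 < radius c := div_pos c.2.1 (one_add_sqrt_pos _)

theorem radius_lt_one (c : Ioo (0 : ℝ) 1) : radius c < 1 := by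
  rw [radius, div_lt_one (one_add_sqrt_pos _)]
  linarith [Real.sqrt_nonneg (1 - (c : ℝ) ^ 2), c.2.2]

theorem doublePt_radius (c : Ioo (0 : ℝ) 1) : doublePt (radius c) = (c : ℝ) := by
  rw [radius_eq, doublePt_halfPt]
  rw [Complex.norm_real, Real.norm_eq_abs, abs_of_pos c.2.1]
  exact c.2.2

/-- The radius as a number in `(0, 1)`. -/
def radiusIoo (c : Ioo (0 : ℝ) 1) : Ioo (0 : ℝ) 1 := ⟨radius c, radius_pos c, radius_lt_one c⟩

instance : Neg disc := ⟨fun z => ⟨-z, by rw [mem_disc, norm_neg]; exact disc_norm_lt z⟩⟩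

theorem disc_coe_neg (z : disc) : ((-z : disc) : ℂ) = -z := rfl

/-- The base pair `(r, -r)` has midpoint `0` and Möbius distance `2r / (1 + r²) = c`, which suits
the coordinates `(w, β)` better than `(c, 0)`. -/
theorem leaf_eq_orbit_radius (c : Ioo (0 : ℝ) 1) :
    leaf c = orbit (symPt (pt (radiusIoo c)) (-pt (radiusIoo c))) := by
  rw [orbit_symPt]
  congr 1
  have h := doublePt_radius c
  have h' : ((pt (radiusIoo c) : disc) : ℂ) = (radius c : ℂ) := rfl
  rw [mobiusDist, involution_apply, disc_coe_neg, h']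
  rw [doublePt, Complex.conj_ofReal] at h
  rw [Complex.conj_ofReal, show ((radius c : ℂ) - -radius c) / (1 - radius c * -radius c) =
    2 * radius c / (1 + radius c * radius c) by ring_nf, h, Complex.norm_real, Real.norm_eq_abs,
    abs_of_pos c.2.1]

/-- With `β = -λα` the automorphism is `z ↦ φ_β(-λz)`. It sends the midpoint `0` of `±r` to `β` and
corresponds to `ρ = ∓λr`, so `w = λ²r²`. -/
theorem sym_mobius_radius (c : Ioo (0 : ℝ) 1) (lam : Circle) (α : disc) :
    sym ((mobius lam α (pt (radiusIoo c)) : ℂ), (mobius lam α (-pt (radiusIoo c)) : ℂ)) =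
      ofMidCoord ((radius c : ℂ) ^ 2 * lam ^ 2, -(lam * α)) := by
  set r := pt (radiusIoo c)
  have hr : (radius c : ℂ) = r := rfl
  have hrc : conj (r : ℂ) = r := Complex.conj_ofReal _
  have hl := circle_mul_conj lam
  have h1 := one_sub_ne_zero (disc_norm_lt α) (disc_norm_lt r)
  have h2 := one_sub_ne_zero (disc_norm_lt α) (disc_norm_lt (-r))
  rw [disc_coe_neg] at h2
  have h2' : 1 + conj (α : ℂ) * r ≠ 0 := by intro h; apply h2; rw [← h]; ring
  have h3 := one_add_mul_conj_ne_zero (α : ℂ)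
  have e1 : ((-((lam : ℂ) * α)) ^ 2 - (radius c : ℂ) ^ 2 * lam ^ 2) /
      (1 - conj ((-((lam : ℂ) * α)) ^ 2) * ((radius c : ℂ) ^ 2 * lam ^ 2)) =
      lam ^ 2 * (α ^ 2 - r ^ 2) / ((1 - conj (α : ℂ) * r) * (1 + conj (α : ℂ) * r)) := by
    rw [hr]
    congr 1
    · ring
    · simp only [map_pow, map_neg, map_mul]
      linear_combination (-(conj (α : ℂ)) ^ 2 * r ^ 2) * (lam * conj (lam : ℂ) + 1) * hl
  have e2 : doublePt (-(lam * α)) = -(2 * lam * α) / (1 + α * conj (α : ℂ)) := by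
    rw [doublePt]
    congr 1
    · ring
    · simp only [map_neg, map_mul]
      linear_combination ((α : ℂ) * conj (α : ℂ)) * hl
  have e3 : conj (doublePt (-(lam * α))) = -(2 * conj (lam : ℂ) * conj (α : ℂ)) /
      (1 + α * conj (α : ℂ)) := by
    rw [e2]
    simp only [map_neg, map_mul, map_div₀, map_add, map_one, Complex.conj_conj, map_ofNat]
    rw [mul_comm (conj (α : ℂ)) α]
  simp only [ofMidCoord]
  rw [e1, e3, e2, sym, mobius_apply, mobius_apply, disc_coe_neg]
  refine Prod.ext ?_ ?_
  · simp only
    have h2'' : 1 - conj (α : ℂ) * -r = 1 + conj (α : ℂ) * r := by ring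
    rw [h2'']
    have e4 : -(2 * conj (lam : ℂ) * conj (α : ℂ)) / (1 + α * conj (α : ℂ)) *
        (lam ^ 2 * (α ^ 2 - r ^ 2) / ((1 - conj (α : ℂ) * r) * (1 + conj (α : ℂ) * r))) =
        -(2 * conj (α : ℂ)) / (1 + α * conj (α : ℂ)) *
        (lam * (α ^ 2 - r ^ 2) / ((1 - conj (α : ℂ) * r) * (1 + conj (α : ℂ) * r))) := by
      rw [div_mul_div_comm, div_mul_div_comm]
      congr 1
      linear_combination (-2 * conj (α : ℂ) * lam * (α ^ 2 - r ^ 2)) * hl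
    rw [e4, div_mul_div_comm, mul_div_assoc', mul_div_assoc', div_add_div _ _ h1 h2',
      div_add_div _ _ h3 (mul_ne_zero h3 (mul_ne_zero h1 h2')), div_eq_div_iff
      (mul_ne_zero h1 h2') (mul_ne_zero h3 (mul_ne_zero h3 (mul_ne_zero h1 h2')))]
    ring
  · simp only
    have h2'' : 1 - conj (α : ℂ) * -r = 1 + conj (α : ℂ) * r := by ring
    rw [h2'', mul_div_assoc', mul_div_assoc', div_mul_div_comm]
    congr 1
    ring

theorem exists_circle_sq (mu : Circle) : ∃ lam : Circle, lam ^ 2 = mu := by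
  refine ⟨Circle.exp (Complex.arg mu / 2), ?_⟩
  rw [sq, ← Circle.exp_add, add_halves, Circle.exp_arg]

theorem circle_disc_mem_midTarget (c : Ioo (0 : ℝ) 1) (mu : Circle) (β : disc) :
    ((radius c : ℂ) ^ 2 * mu, (β : ℂ)) ∈ midTarget := by
  refine ⟨?_, disc_norm_lt β⟩
  rw [norm_mul, Circle.norm_coe, mul_one]
  exact norm_sq_lt_one (by
    rw [Complex.norm_real, Real.norm_eq_abs, abs_of_pos (radius_pos c)]; exact radius_lt_one c)

/-- Every unimodular number is a square, so `(λ², -λα)` takes all values in `S¹ × 𝔻` as the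
automorphism varies. -/
theorem mem_leaf_iff_exists (c : Ioo (0 : ℝ) 1) (x : ℂ × ℂ) :
    x ∈ leaf c ↔ ∃ (mu : Circle) (β : disc), x = ofMidCoord ((radius c : ℂ) ^ 2 * mu, β) := by
  rw [leaf_eq_orbit_radius, mem_orbit_symPt]
  constructor
  · rintro ⟨φ, rfl⟩
    obtain ⟨⟨lam, α⟩, rfl⟩ := mobius_surjective φ
    exact ⟨lam ^ 2, invPt lam α, by
      rw [Circle.coe_pow]; exact sym_mobius_radius c lam α⟩
  · rintro ⟨mu, β, rfl⟩
    obtain ⟨lam, rfl⟩ := exists_circle_sq mu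
    refine ⟨mobius lam (invPt lam⁻¹ β), ?_⟩
    rw [sym_mobius_radius, ← Circle.coe_pow]
    have := congrArg Subtype.val (invPt_invPt lam⁻¹ β)
    rw [inv_inv] at this
    change -((lam : ℂ) * (invPt lam⁻¹ β)) = _ at this
    rw [this]

theorem mem_leaf_iff (c : Ioo (0 : ℝ) 1) (x : ℂ × ℂ) :
    x ∈ leaf c ↔ x ∈ midSource ∧ ‖(midCoord x).1‖ = radius c ^ 2 := by
  have hr := radius_pos c
  have hrn : ‖((radius c : ℂ)) ^ 2‖ = radius c ^ 2 := by
    rw [norm_pow, Complex.norm_real, Real.norm_eq_abs, abs_of_pos hr]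
  rw [mem_leaf_iff_exists]
  constructor
  · rintro ⟨mu, β, rfl⟩
    have h := circle_disc_mem_midTarget c mu β
    refine ⟨ofMidCoord_mem h, ?_⟩
    rw [midCoord_ofMidCoord h, norm_mul, Circle.norm_coe, mul_one, hrn]
  · rintro ⟨hx, h⟩
    obtain ⟨mu, hmu⟩ := exists_circle_mul_eq (hrn.trans h.symm)
    refine ⟨mu, ⟨(midCoord x).2, mem_disc.2 (midCoord_mem hx).2⟩, ?_⟩
    rw [mul_comm, hmu]
    exact (ofMidCoord_midCoord hx).symm

/-! ### The leaves as embedded submanifolds -/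

/-- The splitting `(u, β) ↦ ((Im u, β), Re u)` of `ℂ²`. -/
def splitRe : (ℂ × ℂ) ≃L[ℝ] (EuclideanSpace ℝ (Fin 3) × ℝ) :=
  (((Complex.equivRealProdCLM.prodCongr (ContinuousLinearEquiv.refl ℝ ℂ)).trans
    (ContinuousLinearEquiv.prodAssoc ℝ ℝ ℝ ℂ)).trans
    (ContinuousLinearEquiv.prodComm ℝ ℝ (ℝ × ℂ))).trans
    ((ContinuousLinearEquiv.ofFinrankEq (by
      rw [Module.finrank_prod, Complex.finrank_real_complex, Module.finrank_self,
        finrank_euclideanSpace_fin])).prodCongr (ContinuousLinearEquiv.refl ℝ ℝ))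

/-- The branch `z ↦ log (z / w)` of the logarithm near `w`. -/
def logChart (w : ℂ) (hw : w ≠ 0) : OpenPartialHomeomorph ℂ ℂ :=
  (Homeomorph.mulRight₀ w⁻¹ (inv_ne_zero hw)).toOpenPartialHomeomorph.trans
    Complex.expOpenPartialHomeomorph.symm

theorem mem_logChart_source {w : ℂ} (hw : w ≠ 0) {z : ℂ} :
    z ∈ (logChart w hw).source ↔ z * w⁻¹ ∈ Complex.slitPlane := by
  simp [logChart, Complex.expOpenPartialHomeomorph]

theorem contDiffOn_logChart {n : ℕ∞ω} (w : ℂ) (hw : w ≠ 0) :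
    ContDiffOn ℝ n (logChart w hw) (logChart w hw).source := by
  intro z hz
  rw [mem_logChart_source] at hz
  exact (((Complex.contDiffAt_log hz).restrict_scalars ℝ).comp z
    (contDiff_id.mul contDiff_const).contDiffAt).contDiffWithinAt

theorem contDiff_logChart_symm {n : ℕ∞ω} (w : ℂ) (hw : w ≠ 0) :
    ContDiff ℝ n (logChart w hw).symm := by
  have h : ⇑(logChart w hw).symm = fun z => Complex.exp z * w⁻¹⁻¹ := rfl
  rw [h]
  exact ((Complex.contDiff_exp (𝕜 := ℂ)).restrict_scalars ℝ).mul contDiff_const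

/-- Coordinates on `𝔾` near a point of a leaf in which the leaf is a slice. -/
def leafSliceChart (w : ℂ) (hw : w ≠ 0) :
    OpenPartialHomeomorph (ℂ × ℂ) (EuclideanSpace ℝ (Fin 3) × ℝ) :=
  (midHomeo.trans ((logChart w hw).prod (OpenPartialHomeomorph.refl ℂ))).trans
    splitRe.toHomeomorph.toOpenPartialHomeomorph

theorem mem_leafSliceChart_source {w : ℂ} (hw : w ≠ 0) {x : ℂ × ℂ} :
    x ∈ (leafSliceChart w hw).source ↔
      x ∈ midSource ∧ (midCoord x).1 * w⁻¹ ∈ Complex.slitPlane := by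
  rw [← mem_logChart_source hw]
  simp only [leafSliceChart, mfld_simps]
  rfl

/-- The last coordinate of a point with first coordinate `w'` is `Re log (w' / w) = log (|w'| /
|w|)`, which vanishes exactly when `|w'| = |w| = r²`. -/
theorem isSliceChart_leafSliceChart {n : ℕ∞ω} (c : Ioo (0 : ℝ) 1) {w : ℂ} (hw : w ≠ 0)
    (hwc : ‖w‖ = radius c ^ 2) : IsSliceChart n (leaf c) (leafSliceChart w hw) where
  contDiffOn := by
    refine splitRe.contDiff.comp_contDiffOn ?_
    intro x hx
    rw [mem_leafSliceChart_source] at hx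
    have h1 : ContDiffAt ℝ n midCoord x :=
      contDiffOn_midCoord.contDiffAt (isOpen_midSource.mem_nhds hx.1)
    have h2 : ContDiffAt ℝ n (logChart w hw) (midCoord x).1 :=
      (contDiffOn_logChart w hw).contDiffAt ((logChart w hw).open_source.mem_nhds
        ((mem_logChart_source hw).2 hx.2))
    exact ((h2.comp x (contDiffAt_fst.comp x h1)).prodMk
      (contDiffAt_snd.comp x h1)).contDiffWithinAt
  contDiffOn_symm := by
    have h1 : ContDiff ℝ n (fun y : ℂ × ℂ => ((logChart w hw).symm y.1, y.2)) :=
      ((contDiff_logChart_symm w hw).comp contDiff_fst).prodMk contDiff_snd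
    refine contDiffOn_ofMidCoord.comp (h1.comp splitRe.symm.contDiff).contDiffOn ?_
    intro y hy
    exact hy.2.2
  mem_iff x hx := by
    rw [mem_leafSliceChart_source] at hx
    have e : (leafSliceChart w hw x).2 = Real.log (‖(midCoord x).1‖ / ‖w‖) := by
      change (Complex.log ((midCoord x).1 * w⁻¹)).re = _
      rw [Complex.log_re, ← div_eq_mul_inv, norm_div]
    have hw0 : 0 < ‖w‖ := norm_pos_iff.2 hw
    have h0 : 0 < ‖(midCoord x).1‖ := by
      refine norm_pos_iff.2 fun h => Complex.slitPlane_ne_zero hx.2 ?_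
      rw [h, zero_mul]
    rw [mem_leaf_iff, e, ← hwc, Real.log_eq_zero]
    have hd : 0 < ‖(midCoord x).1‖ / ‖w‖ := div_pos h0 hw0
    constructor
    · rintro ⟨-, h⟩
      rw [h, div_self hw0.ne']
      exact Or.inr (Or.inl rfl)
    -- `Real.log` vanishes at `0`, `1` and `-1`; positivity of the quotient leaves only `1`.
    · rintro (h | h | h)
      · exact absurd h hd.ne'
      · exact ⟨hx.1, (div_eq_one_iff_eq hw0.ne').1 h⟩
      · linarith

theorem exists_isSubmanifoldStructure (c : Ioo (0 : ℝ) 1) :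
    ∃ C : ChartedSpace (EuclideanSpace ℝ (Fin 3)) (leaf c), IsSubmanifoldStructure (leaf c) C := by
  refine exists_submanifold_of_slices splitRe.symm (leaf c) fun x hx => ?_
  obtain ⟨hxs, hxn⟩ := (mem_leaf_iff c x).1 hx
  have hw : (midCoord x).1 ≠ 0 := by
    rw [← norm_pos_iff, hxn]
    exact pow_pos (radius_pos c) 2
  refine ⟨leafSliceChart _ hw, ?_, isSliceChart_leafSliceChart c hw hxn⟩
  rw [mem_leafSliceChart_source, mul_inv_cancel₀ hw]
  exact ⟨hxs, Complex.one_mem_slitPlane⟩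

/-! ### Smooth maps into the circle and the disc -/

section Circle

variable {E H M : Type*} [NormedAddCommGroup E] [NormedSpace ℝ E] [TopologicalSpace H]
  {I : ModelWithCorners ℝ E H} [TopologicalSpace M] [ChartedSpace H M] {n : ℕ∞ω}

theorem contMDiff_circle_coe : ContMDiff (𝓡 1) 𝓘(ℝ, ℂ) n (fun z : Circle => (z : ℂ)) :=
  haveI := finrank_real_complex_fact'
  contMDiff_coe_sphere

theorem contMDiff_circle_of_coe [IsManifold I n M] {f : M → Circle}
    (hf : ContMDiff I 𝓘(ℝ, ℂ) n (fun x => (f x : ℂ))) : ContMDiff I (𝓡 1) n f :=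
  haveI := finrank_real_complex_fact'
  hf.codRestrict_sphere fun x => (f x).2

theorem contMDiff_disc_coe : ContMDiff 𝓘(ℝ, ℂ) 𝓘(ℝ, ℂ) n (fun z : disc => (z : ℂ)) :=
  contMDiff_subtype_val

theorem contMDiff_disc_of_coe {f : M → disc}
    (hf : ContMDiff I 𝓘(ℝ, ℂ) ∞ (fun x => (f x : ℂ))) : ContMDiff I 𝓘(ℝ, ℂ) ∞ f :=
  (ContMDiff.subtypeVal_comp_iff disc f).1 hf

theorem contMDiff_circle_disc_coe :
    ContMDiff modelI 𝓘(ℝ, ℂ × ℂ) n (fun p : Circle × disc => ((p.1 : ℂ), (p.2 : ℂ))) :=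
  (contMDiff_circle_coe.comp contMDiff_fst).prodMk_space (contMDiff_disc_coe.comp contMDiff_snd)

end Circle

/-! ### The leaves are diffeomorphic to `S¹ × 𝔻` -/

/-- The coordinates `(μ, β)` of a point of a leaf. -/
def leafCoord (c : Ioo (0 : ℝ) 1) (x : leaf c) : Circle × disc :=
  (⟨(midCoord x).1 / (radius c : ℂ) ^ 2, by
    change _ ∈ Metric.sphere (0 : ℂ) 1
    have hr := radius_pos c
    rw [mem_sphere_zero_iff_norm, norm_div, ((mem_leaf_iff c x).1 x.2).2, norm_pow,
      Complex.norm_real, Real.norm_eq_abs, abs_of_pos hr, div_self (pow_pos hr 2).ne']⟩,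
    ⟨(midCoord x).2, mem_disc.2 (midCoord_mem ((mem_leaf_iff c x).1 x.2).1).2⟩)

/-- The point of a leaf with coordinates `(μ, β)`. -/
def leafPoint (c : Ioo (0 : ℝ) 1) (p : Circle × disc) : leaf c :=
  ⟨ofMidCoord ((radius c : ℂ) ^ 2 * p.1, p.2), (mem_leaf_iff_exists c _).2 ⟨_, _, rfl⟩⟩

theorem radius_sq_ne_zero (c : Ioo (0 : ℝ) 1) : (radius c : ℂ) ^ 2 ≠ 0 :=
  pow_ne_zero 2 (Complex.ofReal_ne_zero.2 (radius_pos c).ne')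

theorem leafPoint_leafCoord (c : Ioo (0 : ℝ) 1) (x : leaf c) : leafPoint c (leafCoord c x) = x := by
  apply Subtype.ext
  change ofMidCoord ((radius c : ℂ) ^ 2 * ((midCoord x).1 / (radius c : ℂ) ^ 2),
    (midCoord x).2) = x
  rw [mul_div_cancel₀ _ (radius_sq_ne_zero c)]
  exact ofMidCoord_midCoord ((mem_leaf_iff c x).1 x.2).1

theorem leafCoord_leafPoint (c : Ioo (0 : ℝ) 1) (p : Circle × disc) :
    leafCoord c (leafPoint c p) = p := by
  have h : midCoord (leafPoint c p) = ((radius c : ℂ) ^ 2 * p.1, (p.2 : ℂ)) :=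
    midCoord_ofMidCoord (circle_disc_mem_midTarget c p.1 p.2)
  refine Prod.ext (Circle.ext ?_) (Subtype.ext ?_)
  · change (midCoord (leafPoint c p)).1 / (radius c : ℂ) ^ 2 = p.1
    rw [h, mul_div_cancel_left₀ _ (radius_sq_ne_zero c)]
  · change (midCoord (leafPoint c p)).2 = p.2
    rw [h]

theorem contMDiff_coe_leafPoint (c : Ioo (0 : ℝ) 1) :
    ContMDiff modelI 𝓘(ℝ, ℂ × ℂ) ∞ (fun p => (leafPoint c p : ℂ × ℂ)) := by
  have h1 : ContDiff ℝ ∞ (fun y : ℂ × ℂ => ((radius c : ℂ) ^ 2 * y.1, y.2)) :=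
    (contDiff_const.mul contDiff_fst).prodMk contDiff_snd
  exact (contDiffOn_ofMidCoord.contMDiffOn).comp_contMDiff
    (h1.contMDiff.comp contMDiff_circle_disc_coe) fun p => circle_disc_mem_midTarget c p.1 p.2

/-- Only the smooth embedding is used, so the result holds for every submanifold structure `C`: the
coordinates are smooth on the leaf as restrictions of ambient smooth maps. -/
theorem nonempty_diffeomorph_leaf (c : Ioo (0 : ℝ) 1)
    (C : ChartedSpace (EuclideanSpace ℝ (Fin 3)) (leaf c)) (hC : IsSubmanifoldStructure (leaf c) C) :
    Nonempty (Diffeomorph (𝓡 3) modelI (leaf c) (Circle × disc) ∞) := by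
  have h1 : ContMDiff (𝓡 3) 𝓘(ℝ, ℂ × ℂ) ∞ (fun x : leaf c => midCoord x) :=
    contDiffOn_midCoord.contMDiffOn.comp_contMDiff hC.2.contMDiff
      fun x => ((mem_leaf_iff c x).1 x.2).1
  have := hC.1
  refine ⟨{ toFun := leafCoord c, invFun := leafPoint c, left_inv := leafPoint_leafCoord c
            right_inv := leafCoord_leafPoint c, contMDiff_toFun := ?_, contMDiff_invFun := ?_ }⟩
  · refine ContMDiff.prodMk (contMDiff_circle_of_coe ?_) (contMDiff_disc_of_coe ?_)
    · exact (contDiff_fst.div_const ((radius c : ℂ) ^ 2)).contMDiff.comp h1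
    · exact contDiff_snd.contMDiff.comp h1
  -- A continuous map into an immersed manifold is smooth once its composite with the immersion is.
  · exact (ContMDiff.iff_comp_isImmersion hC.2.isImmersion).2
      ⟨continuous_induced_rng.2 (contMDiff_coe_leafPoint c).continuous, contMDiff_coe_leafPoint c⟩

/-! ### Smoothness of the parametrization and of the actions -/

/-- The charts of `DiscAut` are those of `Circle × disc` pulled back along `paramHomeo`, so in
charts this map and its inverse are the identity. -/
theorem contMDiff_paramHomeo : ContMDiff modelI modelI ∞ paramHomeo := by
  intro φ
  have h1 : ContMDiffAt modelI modelI ∞ (chartAt Model (paramHomeo φ)).symm (chartAt Model φ φ) :=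
    contMDiffOn_chart_symm.contMDiffAt ((chartAt Model (paramHomeo φ)).open_target.mem_nhds
      ((chartAt Model (paramHomeo φ)).map_source (mem_chart_source _ _)))
  have h2 : ContMDiffAt modelI modelI ∞ (chartAt Model φ) φ :=
    contMDiffOn_chart.contMDiffAt ((chartAt Model φ).open_source.mem_nhds (mem_chart_source _ _))
  refine (h1.comp φ h2).congr_of_eventuallyEq ?_
  filter_upwards [(chartAt Model φ).open_source.mem_nhds (mem_chart_source _ _)] with ψ hψ
  exact ((chartAt Model (paramHomeo φ)).left_inv hψ.2).symm

theorem contMDiff_paramHomeo_symm : ContMDiff modelI modelI ∞ paramHomeo.symm := by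
  intro p
  obtain ⟨φ, rfl⟩ := paramHomeo.surjective p
  have h1 : ContMDiffAt modelI modelI ∞ (chartAt Model φ).symm
      (chartAt Model (paramHomeo φ) (paramHomeo φ)) :=
    contMDiffOn_chart_symm.contMDiffAt ((chartAt Model φ).open_target.mem_nhds
      ((chartAt Model φ).map_source (mem_chart_source _ _)))
  have h2 : ContMDiffAt modelI modelI ∞ (chartAt Model (paramHomeo φ)) (paramHomeo φ) :=
    contMDiffOn_chart.contMDiffAt ((chartAt Model (paramHomeo φ)).open_source.mem_nhds
      (mem_chart_source _ _))
  refine (h1.comp _ h2).congr_of_eventuallyEq ?_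
  filter_upwards [(chartAt Model (paramHomeo φ)).open_source.mem_nhds (mem_chart_source _ _)]
    with q hq
  change _ = paramHomeo.symm ((chartAt Model (paramHomeo φ)).symm
    (chartAt Model (paramHomeo φ) q))
  rw [(chartAt Model (paramHomeo φ)).left_inv hq]

/-- By `mobius_mul_involution`, in coordinates this is the restriction to `S¹ × 𝔻` of maps smooth on
open subsets of `ℂ²`. -/
theorem contMDiff_mul_involution (a : disc) :
    ContMDiff modelI modelI ∞ (fun φ : DiscAut => φ * involution a) := by
  have hne (p : Circle × disc) : 1 - a * conj (p.2 : ℂ) ≠ 0 := by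
    rw [mul_comm]; exact one_sub_ne_zero (disc_norm_lt p.2) (disc_norm_lt a)
  have hmul : ContMDiff modelI modelI ∞ (fun p : Circle × disc =>
      (-(p.1 * Circle.ofConjDivSelf (1 - a * conj (p.2 : ℂ)) (hne p)), involution a p.2)) := by
    refine ContMDiff.prodMk (contMDiff_circle_of_coe ?_) (contMDiff_disc_of_coe ?_)
    · have h : ContDiffOn ℝ ∞ (fun y : ℂ × ℂ => -(y.1 * (conj (1 - a * conj y.2) /
          (1 - a * conj y.2)))) {y | 1 - a * conj y.2 ≠ 0} := by
        intro y hy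
        have h0 : ContDiff ℝ ∞ (fun y : ℂ × ℂ => 1 - a * conj y.2) :=
          contDiff_const.sub (contDiff_const.mul (contDiff_conj.comp contDiff_snd))
        exact (contDiffAt_fst.mul (contDiffAt_div (contDiff_conj.comp h0).contDiffAt
          h0.contDiffAt hy)).neg.contDiffWithinAt
      refine (h.contMDiffOn.comp_contMDiff contMDiff_circle_disc_coe hne).congr fun p => ?_
      rw [Circle.coe_neg, Circle.coe_mul, coe_ofConjDivSelf]
      rfl
    · have h : ContDiffOn ℝ ∞ (fun y : ℂ × ℂ => (a - y.2) / (1 - conj (a : ℂ) * y.2))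
          {y | ‖y.2‖ < 1} := fun y hy =>
        (contDiffAt_moebius contDiffAt_const contDiffAt_snd (disc_norm_lt a) hy).contDiffWithinAt
      refine (h.contMDiffOn.comp_contMDiff contMDiff_circle_disc_coe
        fun p => disc_norm_lt p.2).congr fun p => ?_
      rw [involution_apply]
      rfl
  refine (contMDiff_paramHomeo_symm.comp (hmul.comp contMDiff_paramHomeo)).congr fun φ => ?_
  have h := mobius_mul_involution (paramHomeo φ).1 (paramHomeo φ).2 a
  exact (congrArg (· * involution a) (paramHomeo.symm_apply_apply φ)).symm.trans h

theorem contMDiff_units_smul (a : disc) (u : ℤˣ) :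
    ContMDiff modelI modelI ∞ (fun φ : TwistedAut a => u • φ) := by
  rcases Int.units_eq_one_or u with rfl | rfl
  · simp only [one_smul]; exact contMDiff_id
  · simp only [neg_one_smul_eq]; exact contMDiff_mul_involution a

theorem neg_one_smul_ne (a : disc) (φ : TwistedAut a) : (-1 : ℤˣ) • φ ≠ φ := by
  intro h
  have := IsCancelSMul.right_cancel (-1 : ℤˣ) 1 φ (h.trans (one_smul _ φ).symm)
  exact absurd this (by decide)

theorem isManifold_autModZ2 (a : disc) : IsManifold modelI ∞ (AutModZ2 a) :=
  isManifold_quotient (contMDiff_units_smul a)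

theorem isLocalDiffeomorph_mk (a : disc) : IsLocalDiffeomorph modelI modelI ∞ (AutModZ2.mk a) :=
  isLocalDiffeomorph_quotientMk (contMDiff_units_smul a)

theorem hasLocalSections_mk (a : disc) : HasLocalSections modelI modelI ∞ (AutModZ2.mk a) :=
  (isLocalDiffeomorph_mk a).hasLocalSections Quotient.mk_surjective

theorem mk_eq_mk_iff (a : disc) (φ ψ : TwistedAut a) :
    AutModZ2.mk a φ = AutModZ2.mk a ψ ↔ ofTwisted a φ = ofTwisted a ψ ∨
      ofTwisted a φ = ofTwisted a ψ * involution a := by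
  have h : AutModZ2.mk a φ = AutModZ2.mk a ψ ↔ ∃ u : ℤˣ, u • ψ = φ :=
    ⟨fun h => orbitRel_apply.1 (Quotient.exact h), fun h => Quotient.sound (orbitRel_apply.2 h)⟩
  rw [h]
  constructor
  · rintro ⟨u, rfl⟩
    rcases Int.units_eq_one_or u with rfl | rfl
    · rw [one_smul]; exact Or.inl rfl
    · rw [neg_one_smul_eq]; exact Or.inr rfl
  · rintro (h | h)
    · exact ⟨1, (one_smul _ ψ).trans h.symm⟩
    · exact ⟨-1, (neg_one_smul_eq a ψ).trans h.symm⟩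

/-! ### The quotients for `c` and for `0` -/

/-- Both sides are the hyperbolic half-turn about the midpoint `m` of `0` and `c`: the right side
sends `0` to `m`, then `-m`, then `2m / (1 + m²) = c`. -/
theorem involution_eq_conj (c : Ioo (0 : ℝ) 1) :
    involution (pt c) =
      involution (pt (radiusIoo c)) * involution 0 * involution (pt (radiusIoo c)) := by
  apply DiscAut.ext
  intro z
  set m := pt (radiusIoo c)
  have hm : conj (m : ℂ) = m := Complex.conj_ofReal _
  have hc : conj (pt c : ℂ) = pt c := Complex.conj_ofReal _
  have hcm : (pt c : ℂ) = 2 * m / (1 + m ^ 2) := by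
    have h := (doublePt_radius c).symm
    rw [doublePt, Complex.conj_ofReal, ← sq] at h
    exact h
  have h0 : 1 + (m : ℂ) ^ 2 ≠ 0 := by
    have := one_add_mul_conj_ne_zero (m : ℂ)
    rwa [hm, ← sq] at this
  have h1 := one_sub_ne_zero (disc_norm_lt m) (disc_norm_lt z)
  have h2 := one_sub_ne_zero (disc_norm_lt m) (disc_norm_lt (involution 0 (involution m z)))
  have h3 := one_sub_ne_zero (disc_norm_lt (pt c)) (disc_norm_lt z)
  rw [DiscAut.mul_apply, DiscAut.mul_apply, involution_apply, involution_apply]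
  rw [involution_zero_apply, involution_apply] at h2 ⊢
  rw [hm] at h1 h2 ⊢
  rw [hc] at h3 ⊢
  rw [hcm] at h3 ⊢
  rw [div_eq_div_iff h3 h2]
  field_simp
  ring

theorem mul_involution_mul_involution (φ : DiscAut) (a : disc) :
    φ * involution a * involution a = φ := by
  rw [mul_assoc, involution_mul_self, mul_one]

/-- Since `φ_c φ_m = φ_m (-id)`, right multiplication by `φ_m`, which is its own inverse, carries
the orbits for `c` to the orbits for `0`. -/
theorem nonempty_diffeomorph_autModZ2 (c : Ioo (0 : ℝ) 1) :
    Nonempty (Diffeomorph modelI modelI (AutModZ2 (pt c)) (AutModZ2 0) ∞) := by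
  set m := pt (radiusIoo c)
  have hmul : ContMDiff modelI modelI ∞ (fun φ : TwistedAut (pt c) =>
    toTwisted 0 (ofTwisted (pt c) φ * involution m)) := contMDiff_mul_involution m
  have hmul' : ContMDiff modelI modelI ∞ (fun φ : TwistedAut 0 =>
    toTwisted (pt c) (ofTwisted 0 φ * involution m)) := contMDiff_mul_involution m
  have hg : HasLocalSections modelI modelI ∞ (fun φ : TwistedAut (pt c) =>
      AutModZ2.mk 0 (toTwisted 0 (ofTwisted (pt c) φ * involution m))) := by
    refine ⟨(hasLocalSections_mk 0).1.comp hmul, fun y => ?_⟩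
    obtain ⟨s, hs, hs'⟩ := (hasLocalSections_mk 0).2 y
    refine ⟨_, hmul'.contMDiffAt.comp y hs, ?_⟩
    filter_upwards [hs'] with z hz
    have h := mul_involution_mul_involution (ofTwisted 0 (s z)) m
    exact (congrArg (fun φ => AutModZ2.mk 0 (toTwisted 0 φ)) h).trans hz
  refine nonempty_diffeomorph_of_hasLocalSections (hasLocalSections_mk (pt c)) hg fun φ ψ => ?_
  rw [mk_eq_mk_iff, mk_eq_mk_iff]
  refine or_congr ?_ ?_
  · exact (mul_left_inj (involution m) : ofTwisted (pt c) φ * involution m = _ ↔ _).symm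
  · change ofTwisted (pt c) φ = ofTwisted (pt c) ψ * involution (pt c) ↔
      ofTwisted (pt c) φ * involution m = ofTwisted (pt c) ψ * involution m * involution 0
    rw [involution_eq_conj c, ← mul_assoc, ← mul_assoc]
    constructor
    · intro h
      rw [h, mul_involution_mul_involution]
    · intro h
      rw [← h, mul_involution_mul_involution]

/-! ### The quotient for `0` is diffeomorphic to `S¹ × 𝔻` -/

/-- The map `(λ, α) ↦ (λ ^ 2, -λ α)`, which is invariant under `(λ, α) ↦ (-λ, -α)`. -/
def squareMap (p : Circle × disc) : Circle × disc := (p.1 ^ 2, invPt p.1 p.2)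

theorem coe_invPt (lam : Circle) (α : disc) : (invPt lam α : ℂ) = -(lam * α) := rfl

theorem contMDiff_invPt : ContMDiff modelI 𝓘(ℝ, ℂ) ∞ (fun p : Circle × disc => invPt p.1 p.2) := by
  refine contMDiff_disc_of_coe ?_
  exact ((contDiff_fst.mul contDiff_snd).neg (𝕜 := ℝ) (E := ℂ × ℂ)).contMDiff.comp
    contMDiff_circle_disc_coe

theorem contMDiff_squareMap : ContMDiff modelI modelI ∞ squareMap :=
  (contMDiff_circle_of_coe
    ((contDiff_fst.pow 2 : ContDiff ℝ ∞ fun y : ℂ × ℂ => y.1 ^ 2).contMDiff.comp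
      contMDiff_circle_disc_coe)).prodMk contMDiff_invPt

theorem hasLocalSections_squareMap : HasLocalSections modelI modelI ∞ squareMap := by
  refine ⟨contMDiff_squareMap, ?_⟩
  rintro ⟨mu, β⟩
  obtain ⟨lam, hlam⟩ := exists_circle_sq mu
  -- A square root of the first coordinate that is smooth near `mu` and equals `lam` there; the
  -- second coordinate of the section is then forced.
  let t : Circle × disc → Circle := fun p =>
    lam * Circle.exp ((Complex.log ((p.1 : ℂ) * ((mu⁻¹ : Circle) : ℂ))).im / 2)
  have hone : (mu : ℂ) * ((mu⁻¹ : Circle) : ℂ) = 1 := by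
    rw [← Circle.coe_mul, mul_inv_cancel, Circle.coe_one]
  have ht : ContMDiffAt modelI (𝓡 1) ∞ t (mu, β) := by
    have h1 : ContDiffAt ℝ ∞
        (fun y : ℂ × ℂ => (Complex.log (y.1 * ((mu⁻¹ : Circle) : ℂ))).im / 2) ((mu : ℂ), (β : ℂ)) := by
      have hl : ContDiffAt ℝ ∞ Complex.log ((mu : ℂ) * ((mu⁻¹ : Circle) : ℂ)) := by
        rw [hone]
        exact (Complex.contDiffAt_log Complex.one_mem_slitPlane).restrict_scalars ℝ
      have hl' := hl.comp ((mu : ℂ), (β : ℂ))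
        (contDiff_fst.mul contDiff_const : ContDiff ℝ ∞
          fun y : ℂ × ℂ => y.1 * ((mu⁻¹ : Circle) : ℂ)).contDiffAt
      exact (Complex.imCLM.contDiff.contDiffAt.comp _ hl').div_const 2
    have h2 := contMDiff_circleExp.contMDiffAt.comp (mu, β)
      (ContMDiffAt.comp (mu, β) h1.contMDiffAt contMDiff_circle_disc_coe.contMDiffAt)
    exact (contMDiff_mul_left (a := lam)).contMDiffAt.comp (mu, β) h2
  -- This holds on the whole circle, since the jump of the argument by `2π` is harmless after
  -- exponentiation; only smoothness needs `p.1` near `mu`.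
  have htsq (p : Circle × disc) : t p ^ 2 = p.1 := by
    rw [mul_pow, hlam, sq (Circle.exp _), ← Circle.exp_add, add_halves, ← Circle.coe_mul,
      Complex.log_im, Circle.exp_arg, mul_inv_cancel_comm_assoc]
  have htinv : ContMDiffAt modelI (𝓡 1) ∞ (fun p => (t p)⁻¹) (mu, β) := ht.inv
  refine ⟨fun p => (t p, invPt (t p)⁻¹ p.2), ht.prodMk ?_, Eventually.of_forall fun p => ?_⟩
  · exact contMDiff_invPt.contMDiffAt.comp (mu, β) (htinv.prodMk contMDiffAt_snd)
  · refine Prod.ext (htsq p) ?_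
    have h := invPt_invPt (t p)⁻¹ p.2
    rwa [inv_inv] at h

theorem mobius_mul_involution_zero (lam : Circle) (α : disc) :
    mobius lam α * involution 0 = mobius (-lam) (-α) := by
  apply DiscAut.ext
  intro z
  rw [DiscAut.mul_apply, mobius_apply, mobius_apply, involution_zero_apply, disc_coe_neg,
    Circle.coe_neg, map_neg]
  rw [show -(z : ℂ) - α = -(z - -α) by ring,
    show 1 - conj (α : ℂ) * -z = 1 - -conj (α : ℂ) * z by ring]
  ring

theorem squareMap_eq_iff (p q : Circle × disc) :
    squareMap p = squareMap q ↔ p = q ∨ p = (-q.1, -q.2) := by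
  constructor
  · intro h
    have h1 : (p.1 : ℂ) ^ 2 = (q.1 : ℂ) ^ 2 := by
      have := congrArg (fun r : Circle × disc => (r.1 : ℂ)) h
      simpa only [squareMap, Circle.coe_pow] using this
    have h2 : (p.1 : ℂ) * p.2 = q.1 * q.2 := by
      have := congrArg (fun r : Circle × disc => (r.2 : ℂ)) h
      simpa only [squareMap, coe_invPt, neg_inj] using this
    rcases sq_eq_sq_iff_eq_or_eq_neg.1 h1 with h3 | h3
    · rw [h3] at h2
      exact Or.inl (Prod.ext (Circle.ext h3)
        (Subtype.ext (mul_left_cancel₀ q.1.coe_ne_zero h2)))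
    · rw [h3, neg_mul, ← mul_neg] at h2
      have h4 := mul_left_cancel₀ q.1.coe_ne_zero h2
      refine Or.inr (Prod.ext (Circle.ext (by rw [Circle.coe_neg]; exact h3)) (Subtype.ext ?_))
      rw [disc_coe_neg, ← h4, neg_neg]
  · rintro (rfl | rfl)
    · rfl
    · refine Prod.ext (Circle.ext ?_) (Subtype.ext ?_)
      · simp only [squareMap, Circle.coe_pow, even_two.neg_pow]
      · simp only [squareMap, coe_invPt, Circle.coe_neg, disc_coe_neg, neg_mul_neg]

/-- The fibres `{(λ, α), (-λ, -α)}` of `squareMap` are the orbits of composition with `-id`, so the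
quotient map and `squareMap` have diffeomorphic codomains. -/
theorem nonempty_diffeomorph_autModZ2_zero :
    Nonempty (Diffeomorph modelI modelI (AutModZ2 0) (Circle × disc) ∞) := by
  have hp : ContMDiff modelI modelI ∞ (fun φ : TwistedAut 0 => paramHomeo (ofTwisted 0 φ)) :=
    contMDiff_paramHomeo
  have hp' : ContMDiff modelI modelI ∞ (fun p => toTwisted 0 (paramHomeo.symm p)) :=
    contMDiff_paramHomeo_symm
  have hg : HasLocalSections modelI modelI ∞
      (fun φ : TwistedAut 0 => squareMap (paramHomeo (ofTwisted 0 φ))) := by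
    refine ⟨contMDiff_squareMap.comp hp, fun y => ?_⟩
    obtain ⟨s, hs, hs'⟩ := hasLocalSections_squareMap.2 y
    refine ⟨_, hp'.contMDiffAt.comp y hs, ?_⟩
    filter_upwards [hs'] with z hz
    exact (congrArg squareMap (paramHomeo.apply_symm_apply (s z))).trans hz
  refine nonempty_diffeomorph_of_hasLocalSections (hasLocalSections_mk 0) hg fun φ ψ => ?_
  rw [mk_eq_mk_iff]
  generalize ofTwisted 0 φ = φ
  generalize ofTwisted 0 ψ = ψ
  obtain ⟨p, rfl⟩ := paramHomeo.symm.surjective φ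
  obtain ⟨q, rfl⟩ := paramHomeo.symm.surjective ψ
  rw [paramHomeo.apply_symm_apply, paramHomeo.apply_symm_apply, squareMap_eq_iff,
    paramHomeo.symm.injective.eq_iff]
  refine or_congr_right ?_
  rw [paramHomeo_symm_apply q, mobius_mul_involution_zero]
  exact paramHomeo.symm.injective.eq_iff (b := (-q.1, -q.2))

end

end SymBidisc

theorem mainTheorem5 :
    -- the leaves `𝓛_c` are the orbits in `𝔾` other than the royal variety
    (∀ c : Set.Ioo (0 : ℝ) 1,
      leaf c = orbit (symPt (pt c) 0)) ∧
    (∀ x : symBidisc, (x : ℂ × ℂ) ∉ royal →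
      ∃ c : Set.Ioo (0 : ℝ) 1, orbit x = leaf c) ∧
    -- each `𝓛_c` is an embedded real three-dimensional submanifold of `ℂ²`
    (∀ c : Set.Ioo (0 : ℝ) 1, ∃ C : ChartedSpace (EuclideanSpace ℝ (Fin 3)) (leaf c),
      IsSubmanifoldStructure (leaf c) C) ∧
    -- the actions of `ℤ₂` are free, and the quotients are quotient manifolds
    (∀ a : disc,
      (∀ φ : TwistedAut a, (-1 : ℤˣ) • φ ≠ φ) ∧
      IsManifold modelI ∞ (AutModZ2 a) ∧
      IsLocalDiffeomorph modelI modelI ∞ (AutModZ2.mk a)) ∧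
    -- `𝓛_c` is diffeomorphic with the quotients for `c` and for `0`
    (∀ (c : Set.Ioo (0 : ℝ) 1) (C : ChartedSpace (EuclideanSpace ℝ (Fin 3)) (leaf c)),
      IsSubmanifoldStructure (leaf c) C →
      Nonempty (Diffeomorph (𝓡 3) modelI (leaf c)
        (AutModZ2 (pt c)) ∞) ∧
      Nonempty (Diffeomorph (𝓡 3) modelI (leaf c)
        (AutModZ2 0) ∞)) ∧
    -- the quotients for `c` and for `0` are diffeomorphic
    (∀ c : Set.Ioo (0 : ℝ) 1,
      Nonempty (Diffeomorph modelI modelI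
        (AutModZ2 (pt c)) (AutModZ2 0) ∞)) ∧
    -- any two leaves are diffeomorphic
    (∀ (c d : Set.Ioo (0 : ℝ) 1)
      (C : ChartedSpace (EuclideanSpace ℝ (Fin 3)) (leaf c))
      (D : ChartedSpace (EuclideanSpace ℝ (Fin 3)) (leaf d)),
      IsSubmanifoldStructure (leaf c) C →
      IsSubmanifoldStructure (leaf d) D →
      Nonempty (Diffeomorph (𝓡 3) (𝓡 3) (leaf c) (leaf d) ∞)) := by
  refine ⟨leaf_eq_orbit, exists_orbit_eq_leaf, exists_isSubmanifoldStructure,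
    fun a => ⟨neg_one_smul_ne a, isManifold_autModZ2 a, isLocalDiffeomorph_mk a⟩,
    fun c C hC => ?_, nonempty_diffeomorph_autModZ2, fun c d C D hC hD => ?_⟩
  · obtain ⟨e⟩ := nonempty_diffeomorph_leaf c C hC
    obtain ⟨f⟩ := nonempty_diffeomorph_autModZ2_zero
    obtain ⟨g⟩ := nonempty_diffeomorph_autModZ2 c
    exact ⟨⟨(e.trans f.symm).trans g.symm⟩, ⟨e.trans f.symm⟩⟩
  · obtain ⟨e⟩ := nonempty_diffeomorph_leaf c C hC
    obtain ⟨f⟩ := nonempty_diffeomorph_leaf d D hD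
    exact ⟨e.trans f.symm⟩
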